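/- Let $-1<\alpha_1<\beta_1<\alpha_2<\beta_2<\dots<\alpha_g<\beta_g<1$ ($g\ge 0$), let $E=[-1,1]\setminus\bigcup_{i=1}^g(\alpha_i,\beta_i)$ and $$w(x)=\frac1\pi\sqrt{\frac{\prod_{i=1}^g(x-\alpha_i)}{(1-x^2)\prod_{i=1}^g(x-\beta_i)}}\qquad(x\in E).$$ Let $P_0,P_1,P_2,\dots$ be the monic polynomials orthogonal on $E$ with respect to $w$, let $$Q_n(x)=\int_E\frac{P_n(x)-P_n(t)}{x-t}\,w(t)\,dt$$ be the polynomials of the second kind, and let $a_n,b_n$ be the coefficients of the recurrence $xP_n=P_{n+1}+b_{n+1}P_n+a_nP_{n-1}$ $(n\ge1)$, $xP_0=P_1+b_1P_0$. Suppose that the recurrence coefficients are periodic with period $\mathfrak K$, that is, $b_{n+\mathfrak K}=b_n$ for $n\ge1$ and $a_{n+\mathfrak K}=a_n$ for $n\ge2$. Let $n\ge1$ and $1\le j<\mathfrak K$, let $A$ be the set of the zeros of $P_{n\mathfrak K}$ and of $P_j$, and let $$B=\bigl(\{-1,1,\beta_1,\dots,\beta_g\}\cup\{y:Q_j(y)=0\}\cup\{y:Q_{n\mathfrak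 K}(y)=0\}\bigr)\setminus\{\alpha_1,\dots,\alpha_g\}.$$ Then: 1. Strictly between any zero of $P_j$ and any larger element of $B$ there lies at least one zero of $P_{n\mathfrak K+j}$. 2. Strictly between any zero of $Q_j$ and any larger element of $A$ there lies at least one zero of $P_{n\mathfrak K+j}$. 3. If $P_j$ vanishes at a point of $B$, then $P_{n\mathfrak K+j}$ vanishes at the same point. -/

import Mathlib

open Polynomial MeasureTheory

namespace GenChebyshev

noncomputable section

/-- The gaps `(α i, β i)`, `i = 0, …, g - 1`, are nonempty open intervals inside `(-1, 1)`, listed from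
left to right and separated by nondegenerate closed intervals:
`-1 < α 0 < β 0 < α 1 < β 1 < … < α (g - 1) < β (g - 1) < 1`. -/
def IsGapSystem {g : ℕ} (α β : Fin g → ℝ) : Prop :=
  (∀ i, -1 < α i ∧ α i < β i ∧ β i < 1) ∧ ∀ i k, i < k → β i < α k

/-- The set `E = [-1, α 0] ∪ [β 0, α 1] ∪ … ∪ [β (g - 1), 1]`, that is, `[-1, 1]` without the open gaps. -/
def E {g : ℕ} (α β : Fin g → ℝ) : Set ℝ :=
  Set.Icc (-1) 1 \ ⋃ i, Set.Ioo (α i) (β i)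

/-- The weight `w(x) = (1/π) √(∏ (x - α i) / ((1 - x²) ∏ (x - β i)))`. The radicand is nonnegative on `E`
away from the finitely many endpoints where the denominator vanishes. -/
def w {g : ℕ} (α β : Fin g → ℝ) (x : ℝ) : ℝ :=
  1 / Real.pi * Real.sqrt ((∏ i, (x - α i)) / ((1 - x ^ 2) * ∏ i, (x - β i)))

/-- The inner product `∫_E p(x) q(x) w(x) dx` of two real polynomials. -/
def ip {g : ℕ} (α β : Fin g → ℝ) (p q : ℝ[X]) : ℝ :=
  ∫ x in E α β, p.eval x * q.eval x * w α β x

/-- The monic orthogonal polynomials with respect to `w` on `E` (generalized Chebyshev polynomials of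
the first kind), obtained from `1, X, X², …` by the Gram-Schmidt process without normalization. -/
def P {g : ℕ} (α β : Fin g → ℝ) (n : ℕ) : ℝ[X] :=
  X ^ n - ∑ k : Fin n,
    C (ip α β (X ^ n) (P α β k) / ip α β (P α β k) (P α β k)) * P α β k
termination_by n
decreasing_by all_goals exact k.2

/-- The polynomials of the second kind `Q_n(x) = ∫_E (P_n(x) - P_n(t)) / (x - t) w(t) dt`, as functions.
The single point `t = x` is a null set. -/
def Q {g : ℕ} (α β : Fin g → ℝ) (n : ℕ) (x : ℝ) : ℝ :=
  ∫ t in E α β, ((P α β n).eval x - (P α β n).eval t) / (x - t) * w α β t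

/-- `a` and `b` are the coefficients of the three term recurrence
`x P_n = P_{n+1} + b_{n+1} P_n + a_n P_{n-1}` (for `n = 0` without the last term).
The values `a 0` and `b 0` play no role. -/
def IsRecurrence {g : ℕ} (α β : Fin g → ℝ) (a b : ℕ → ℝ) : Prop :=
  X * P α β 0 = P α β 1 + C (b 1) * P α β 0 ∧
  ∀ n : ℕ, 1 ≤ n →
    X * P α β n = P α β (n + 1) + C (b (n + 1)) * P α β n + C (a n) * P α β (n - 1)

/-- The recurrence coefficients are periodic with (not necessarily least) period `K`:
`b_{n+K} = b_n` for `n ≥ 1` and `a_{n+K} = a_n` for `n ≥ 2`. -/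
def HasPeriod {g : ℕ} (α β : Fin g → ℝ) (K : ℕ) : Prop :=
  ∃ a b : ℕ → ℝ, IsRecurrence α β a b ∧
    (∀ n, 1 ≤ n → b (n + K) = b n) ∧ ∀ n, 2 ≤ n → a (n + K) = a n

/-- The real zeros of `P_n`. -/
def zerosP {g : ℕ} (α β : Fin g → ℝ) (n : ℕ) : Set ℝ := {x | (P α β n).eval x = 0}

/-- The real zeros of `Q_n`. -/
def zerosQ {g : ℕ} (α β : Fin g → ℝ) (n : ℕ) : Set ℝ := {x | Q α β n x = 0}

/-- The set `A`: the zeros of `P_{nK}` and of `P_j`. -/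
def setA {g : ℕ} (α β : Fin g → ℝ) (K n j : ℕ) : Set ℝ :=
  zerosP α β (n * K) ∪ zerosP α β j

/-- The set `B`: the points `±1` and `β i`, the zeros of `Q_j` and of `Q_{nK}`, without the points
`α i`. -/
def setB {g : ℕ} (α β : Fin g → ℝ) (K n j : ℕ) : Set ℝ :=
  ({-1, 1} ∪ Set.range β ∪ zerosQ α β j ∪ zerosQ α β (n * K)) \ Set.range α

end

end GenChebyshev

open Filter Topology Set

namespace GenChebyshev

/-! Put M = nK and let P_m, Q_m be the solutions `fstKind`, `sndKind` of the recurrence. Everything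
rests on a polynomial G with 2P_{M+1} = P_1 P_M + G, 2Q_{M+1} = P_M + P_1 Q_M and G ∏(x - α_i) = Q_M
(x² - 1) ∏(x - β_i) (`exists_periodicData`). These give the addition formula 2P_{M+j} = P_M P_j + G
Q_j (`PeriodicData.fst_add`). Each element of B is a zero of G Q_j, so the third claim is immediate.

For the first claim, P_j/Q_j and G/P_M increase between their poles. The reflected solution r_j =
P_M P_j - G Q_j of the recurrence has negative Christoffel-Darboux expressions for j < M, those of
P_j are positive, and the Wronskian of P and r is a positive constant times G; hence P_j r_j / G
decreases. If P_{M+j} had no zero between a zero of P_j and the next zero of G Q_j, these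
monotonicities would fix all signs and give (P_M P_j)² ≤ (G Q_j)² up to the right end point. There
the right side vanishes, which leads to a contradiction (`exists_zero_of_consecutive`). The second
claim is the same argument with P_j, P_M and Q_j, G exchanged, up to signs.

The identities for G come from the Stieltjes transform F of w. Cauchy's theorem gives F² = ∏(x -
α_i) / ((x² - 1) ∏(x - β_i)) for x > 1 (`integral_w_div`). The functions P_m F - Q_m are O(x^{-m-1})
and solve the recurrence, so their Wronskian with their own shift by M decays faster than every
power (`rapidDecay_period`). That Wronskian is a quadratic polynomial in F with polynomial
coefficients. Since F² is rational with a simple pole at 1, the part linear in F and the rest vanish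
separately (`quadratic_relation`). Comparing leading coefficients yields a_1 = 2a_{M+1}. -/

/-! ### Zeros of a sum of two products under monotone quotients. -/

/-- A polynomial with a simple zero at `p` has the sign of its derivative just to the right of `p`. -/
lemma eventually_pos_right_of_deriv_pos {f : ℝ[X]} {p : ℝ} (h0 : f.eval p = 0)
    (h1 : 0 < f.derivative.eval p) : ∀ᶠ x in 𝓝[>] p, 0 < f.eval x := by
  obtain ⟨g, rfl⟩ := dvd_iff_isRoot.mpr h0
  have hg : 0 < g.eval p := by simpa [derivative_mul] using h1
  have := (g.continuous.tendsto p).eventually (lt_mem_nhds hg)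
  filter_upwards [nhdsWithin_le_nhds this, self_mem_nhdsWithin] with x hx hpx
  simp only [mem_Ioi] at hpx
  simp only [eval_mul, eval_sub, eval_X, eval_C]
  exact mul_pos (by linarith) hx

/-- A polynomial with a simple zero at `b` has the sign opposite to its derivative just to the left. -/
lemma eventually_neg_left_of_deriv_pos {f : ℝ[X]} {b : ℝ} (h0 : f.eval b = 0)
    (h1 : 0 < f.derivative.eval b) : ∀ᶠ x in 𝓝[<] b, f.eval x < 0 := by
  obtain ⟨g, rfl⟩ := dvd_iff_isRoot.mpr h0
  have hg : 0 < g.eval b := by simpa [derivative_mul] using h1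
  have := (g.continuous.tendsto b).eventually (lt_mem_nhds hg)
  filter_upwards [nhdsWithin_le_nhds this, self_mem_nhdsWithin] with x hx hpx
  simp only [mem_Iio] at hpx
  simp only [eval_mul, eval_sub, eval_X, eval_C]
  exact mul_neg_of_neg_of_pos (by linarith) hx

/-- A zero-free polynomial on `(p, b)` that is positive near `p` is positive on `(p, b)`. -/
lemma pos_on_Ioo_of_eventually {f : ℝ[X]} {p b : ℝ} (hne : ∀ x ∈ Ioo p b, f.eval x ≠ 0)
    (hev : ∀ᶠ x in 𝓝[>] p, 0 < f.eval x) : ∀ x ∈ Ioo p b, 0 < f.eval x := by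
  intro x hx
  by_contra! hneg
  obtain ⟨y, hy, hpy⟩ := (hev.and (Ioo_mem_nhdsGT hx.1)).exists
  obtain ⟨z, hz, hz0⟩ := intermediate_value_Icc' hpy.2.le f.continuous.continuousOn
    (show (0 : ℝ) ∈ Icc (f.eval x) (f.eval y) from ⟨hneg, hy.le⟩)
  exact hne z ⟨hpy.1.trans_le hz.1, hz.2.trans_lt hx.2⟩ hz0

/-- Zeros of `U u + V v` between a zero of `u` and the next zero of `v V`. -/
lemma exists_zero_of_consecutive {u v U V : ℝ[X]}
    (huv : ∀ x, 0 < u.derivative.eval x * v.eval x - u.eval x * v.derivative.eval x)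
    (hVU : ∀ x, 0 < V.derivative.eval x * U.eval x - V.eval x * U.derivative.eval x)
    (hdec : ∀ x, V.eval x ≠ 0 → (u * (u * U - v * V)).derivative.eval x * V.eval x -
      (u * (u * U - v * V)).eval x * V.derivative.eval x < 0)
    {p b : ℝ} (hpb : p < b) (hp : u.eval p = 0) (hb : v.eval b = 0 ∨ V.eval b = 0)
    (hv : ∀ x ∈ Ioo p b, v.eval x ≠ 0) (hV : ∀ x ∈ Ioo p b, V.eval x ≠ 0)
    (hu : ∀ x ∈ Ioo p b, u.eval x ≠ 0) :
    ∃ z ∈ Ioo p b, (U * u + V * v).eval z = 0 := by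
  by_contra! hZ
  have hup : 0 < u.derivative.eval p * v.eval p := by simpa [hp] using huv p
  have hvp : v.eval p ≠ 0 := fun h => by simp [h] at hup
  -- the product `u v` is positive
  have huvpos : ∀ x ∈ Ioo p b, 0 < (u * v).eval x := by
    refine pos_on_Ioo_of_eventually (fun x hx => ?_) (eventually_pos_right_of_deriv_pos ?_ ?_)
    · simpa using ⟨hu x hx, hv x hx⟩
    · simp [hp]
    · simpa [hp, derivative_mul] using hup
  -- so is the product of `V v` and the sum
  have hYZ : ∀ x ∈ Ioo p b, 0 < ((V * v) * (U * u + V * v)).eval x := by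
    refine pos_on_Ioo_of_eventually (fun x hx => ?_) ?_
    · rw [eval_mul]
      exact mul_ne_zero (by simpa using ⟨hV x hx, hv x hx⟩) (hZ x hx)
    -- If V vanishes at p, a factor (x - p)² splits off. The cofactor at p is V₁U·u₁v + (V₁v)², and
    -- V₁U and u₁v are positive there by the two monotonicity hypotheses.
    · by_cases hVp : V.eval p = 0
      · have h2 : 0 < V.derivative.eval p * U.eval p := by simpa [hVp] using hVU p
        obtain ⟨V1, rfl⟩ := dvd_iff_isRoot.mpr hVp
        obtain ⟨u1, rfl⟩ := dvd_iff_isRoot.mpr hp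
        simp only [derivative_mul, derivative_sub, derivative_X, derivative_C, eval_add, eval_mul,
          eval_sub, eval_X, eval_C, sub_self, sub_zero, zero_mul, add_zero, one_mul]
          at h2 hup
        have h3 : 0 < ((V1 * v) * (U * u1 + V1 * v)).eval p := by
          simp only [eval_mul, eval_add]
          have : V1.eval p ≠ 0 := fun h => by simp [h] at h2
          have h4 := mul_pos h2 hup
          have : 0 < (V1.eval p * v.eval p) ^ 2 := by positivity
          nlinarith
        have := (((V1 * v) * (U * u1 + V1 * v)).continuous.tendsto p).eventually (lt_mem_nhds h3)
        filter_upwards [nhdsWithin_le_nhds this, self_mem_nhdsWithin] with x hx hpx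
        simp only [mem_Ioi] at hpx
        have e : (((X - C p) * V1 * v) * (U * ((X - C p) * u1) + (X - C p) * V1 * v)).eval x =
            (x - p) ^ 2 * ((V1 * v) * (U * u1 + V1 * v)).eval x := by
          simp only [eval_mul, eval_add, eval_sub, eval_X, eval_C]; ring
        rw [e]
        exact mul_pos (by nlinarith) hx
      · have h3 : 0 < ((V * v) * (U * u + V * v)).eval p := by
          simp only [eval_mul, eval_add, hp, mul_zero, zero_add]
          exact mul_self_pos.mpr (mul_ne_zero hVp hvp)
        exact nhdsWithin_le_nhds
          ((((V * v) * (U * u + V * v)).continuous.tendsto p).eventually (lt_mem_nhds h3))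
  set S : ℝ[X] := u * (u * U - v * V) with hS
  have hderiv : ∀ x, V.eval x ≠ 0 → HasDerivAt (fun y => S.eval y / V.eval y)
      ((S.derivative.eval x * V.eval x - S.eval x * V.derivative.eval x) / V.eval x ^ 2) x :=
    fun x hx => (S.hasDerivAt x).div (V.hasDerivAt x) hx
  have hanti : ∀ s : Set ℝ, Convex ℝ s → (∀ x ∈ s, V.eval x ≠ 0) →
      StrictAntiOn (fun y => S.eval y / V.eval y) s := by
    intro s hs hne
    refine strictAntiOn_of_deriv_neg hs
      (fun x hx => (hderiv x (hne x hx)).continuousAt.continuousWithinAt) (fun x hx => ?_)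
    have hx' := hne x (interior_subset hx)
    rw [(hderiv x hx').deriv]
    exact div_neg_of_neg_of_pos (hdec x hx') (by positivity)
  -- the quotient tends to `0` at `p`
  have hlim : Tendsto (fun y => S.eval y / V.eval y) (𝓝[>] p) (𝓝 0) := by
    by_cases hVp : V.eval p = 0
    · have h2 : 0 < V.derivative.eval p * U.eval p := by simpa [hVp] using hVU p
      obtain ⟨V1, hV1⟩ := dvd_iff_isRoot.mpr hVp
      obtain ⟨u1, hu1⟩ := dvd_iff_isRoot.mpr hp
      have hV1p : V1.eval p ≠ 0 := fun h => by simp [hV1, h, derivative_mul] at h2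
      have : Tendsto (fun y => (u1 * (u * U - v * V)).eval y / V1.eval y) (𝓝[>] p)
          (𝓝 ((u1 * (u * U - v * V)).eval p / V1.eval p)) :=
        (((u1 * (u * U - v * V)).continuous.tendsto p).div (V1.continuous.tendsto p) hV1p).mono_left
          nhdsWithin_le_nhds
      have e0 : (u1 * (u * U - v * V)).eval p / V1.eval p = 0 := by simp [hp, hVp]
      rw [e0] at this
      refine this.congr' ?_
      filter_upwards [self_mem_nhdsWithin] with x hpx
      simp only [mem_Ioi] at hpx
      have hne : x - p ≠ 0 := by linarith
      have e1 : S.eval x = (x - p) * (u1 * (u * U - v * V)).eval x := by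
        rw [hS, eval_mul, eval_mul]
        conv_lhs => rw [hu1]
        simp only [eval_mul, eval_sub, eval_X, eval_C]
        rw [hu1]
        simp only [eval_mul, eval_sub, eval_X, eval_C]
        ring
      have e2 : V.eval x = (x - p) * V1.eval x := by rw [hV1]; simp
      rw [e1, e2, mul_div_mul_left _ _ hne]
    · have := (hderiv p hVp).continuousAt.tendsto
      simp only [hS, eval_mul, hp, zero_mul, zero_div] at this
      exact (by simpa [hS, eval_mul] using this.mono_left nhdsWithin_le_nhds)
  have hneg : ∀ x ∈ Ioo p b, S.eval x / V.eval x < 0 := by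
    intro x hx
    have hA := hanti (Ioo p b) (convex_Ioo p b) hV
    obtain ⟨m, hm⟩ := exists_between hx.1
    have hmI : m ∈ Ioo p b := ⟨hm.1, hm.2.trans hx.2⟩
    refine (hA hmI hx hm.2).trans_le (ge_of_tendsto hlim ?_)
    filter_upwards [Ioo_mem_nhdsGT hm.1] with y hy
    exact (hA ⟨hy.1, hy.2.trans hmI.2⟩ hmI hy.2).le
  -- With s = Uu and t = Vv, the decrease of S/V from 0 together with uv > 0 gives t(s - t) < 0,
  -- while `hYZ` gives t(s + t) > 0. The product of the two yields s² < t².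
  have hle : ∀ x ∈ Ioo p b, (U * u).eval x ^ 2 ≤ (V * v).eval x ^ 2 := by
    intro x hx
    have h1 := hneg x hx
    have h2 := hYZ x hx
    have h3 := huvpos x hx
    have hVx := hV x hx
    simp only [hS, eval_mul, eval_add, eval_sub] at h1 h2 h3 ⊢
    have h4 : u.eval x * (u.eval x * U.eval x - v.eval x * V.eval x) * V.eval x < 0 := by
      rcases div_neg_iff.mp h1 with h | h
      · exact mul_neg_of_pos_of_neg h.1 h.2
      · exact mul_neg_of_neg_of_pos h.1 h.2
    have h5 : V.eval x * v.eval x * (U.eval x * u.eval x - V.eval x * v.eval x) < 0 := by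
      have hu2 : 0 < u.eval x ^ 2 := by have := hu x hx; positivity
      have := mul_neg_of_pos_of_neg h3 h4
      have e : u.eval x * v.eval x *
          (u.eval x * (u.eval x * U.eval x - v.eval x * V.eval x) * V.eval x) =
          u.eval x ^ 2 * (V.eval x * v.eval x * (U.eval x * u.eval x - V.eval x * v.eval x)) := by
        ring
      rw [e] at this
      exact neg_of_mul_neg_right this hu2.le
    set s := U.eval x * u.eval x
    set t := V.eval x * v.eval x
    have ht : t ≠ 0 := mul_ne_zero hVx (hv x hx)
    have ht2 : 0 < t ^ 2 := by positivity
    by_contra! hc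
    nlinarith [mul_pos h2 (neg_pos.mpr h5)]
  have hleb : (U * u).eval b ^ 2 ≤ (V * v).eval b ^ 2 := by
    have c1 := (((U * u).continuous.pow 2).tendsto b).mono_left (nhdsWithin_le_nhds (s := Iio b))
    have c2 := (((V * v).continuous.pow 2).tendsto b).mono_left (nhdsWithin_le_nhds (s := Iio b))
    exact le_of_tendsto_of_tendsto c1 c2 (by
      filter_upwards [Ioo_mem_nhdsLT hpb] with x hx using hle x hx)
  have hYb : (V * v).eval b = 0 := by
    rcases hb with h | h <;> simp [h]
  have hXb : U.eval b * u.eval b = 0 := by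
    rw [hYb] at hleb
    have h0 : (U * u).eval b ^ 2 = 0 := le_antisymm (by simpa using hleb) (sq_nonneg _)
    rw [eval_mul] at h0
    exact pow_eq_zero_iff two_ne_zero |>.mp h0
  -- At a zero of u the derivative of uv is positive, so uv would be negative just to the left of b.
  have hub : u.eval b ≠ 0 := by
    intro h
    have h1 : 0 < u.derivative.eval b * v.eval b := by simpa [h] using huv b
    obtain ⟨x, hx, hx'⟩ := ((eventually_neg_left_of_deriv_pos (f := u * v) (b := b) (by simp [h])
      (by simpa [h, derivative_mul] using h1)).and (Ioo_mem_nhdsLT hpb)).exists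
    exact (huvpos x hx').not_gt hx
  have hUb : U.eval b = 0 := by simpa [hub] using hXb
  have hVb : V.eval b ≠ 0 := by
    intro h
    have := hVU b
    simp [h, hUb] at this
  have hvb : v.eval b = 0 := by simpa [hVb] using hb
  -- What remains is U(b) = v(b) = 0 with V(b) ≠ 0. Then S/V is 0 at b, although it is negative on
  -- (p, b) and strictly decreasing up to b.
  obtain ⟨m, hm⟩ := exists_between hpb
  have hA := hanti (Ioc p b) (convex_Ioc p b) (fun x hx => by
    rcases hx.2.lt_or_eq with h | h
    · exact hV x ⟨hx.1, h⟩
    · rw [h]; exact hVb)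
  have h1 := hA ⟨hm.1, hm.2.le⟩ ⟨hpb, le_rfl⟩ hm.2
  have h2 := hneg m hm
  simp only [hS, eval_mul, eval_sub, hUb, hvb, mul_zero, zero_mul, sub_zero, zero_div] at h1
  simp only [hS, eval_mul, eval_sub] at h2
  linarith

/-- Zeros of `U u + V v` between a zero of `u` and any larger zero of `v V`. -/
lemma exists_zero_between {u v U V : ℝ[X]}
    (huv : ∀ x, 0 < u.derivative.eval x * v.eval x - u.eval x * v.derivative.eval x)
    (hVU : ∀ x, 0 < V.derivative.eval x * U.eval x - V.eval x * U.derivative.eval x)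
    (hdec : ∀ x, V.eval x ≠ 0 → (u * (u * U - v * V)).derivative.eval x * V.eval x -
      (u * (u * U - v * V)).eval x * V.derivative.eval x < 0)
    {p b : ℝ} (hpb : p < b) (hp : u.eval p = 0) (hb : v.eval b = 0 ∨ V.eval b = 0) :
    ∃ z, p < z ∧ z < b ∧ (U * u + V * v).eval z = 0 := by
  classical
  have hu0 : u ≠ 0 := by rintro rfl; simpa using huv 0
  have hv0 : v ≠ 0 := by rintro rfl; simpa using huv 0
  have hV0 : V ≠ 0 := by rintro rfl; simpa using hVU 0
  have hmem : ∀ x, x ∈ (v * V).roots.toFinset ↔ v.eval x = 0 ∨ V.eval x = 0 := by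
    intro x; simp [hv0, hV0]
  -- Reduction to neighbouring zeros: b' is the first zero of vV to the right of p, and then p' is
  -- the last zero of u before b'.
  set s := (v * V).roots.toFinset.filter (p < ·) with hs
  have hbs : b ∈ s := by simp only [hs, Finset.mem_filter, hmem]; exact ⟨hb, hpb⟩
  set b' := s.min' ⟨b, hbs⟩ with hb'
  have hb's : b' ∈ s := s.min'_mem _
  have hb'b : b' ≤ b := s.min'_le _ hbs
  simp only [hs, Finset.mem_filter, hmem] at hb's
  set t := u.roots.toFinset.filter (· < b') with ht
  have hpt : p ∈ t := by simp [ht, hu0, hp, hb's.2]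
  set p' := t.max' ⟨p, hpt⟩ with hp'
  have hp't : p' ∈ t := t.max'_mem _
  have hpp' : p ≤ p' := t.le_max' _ hpt
  simp only [ht, Finset.mem_filter, Multiset.mem_toFinset, mem_roots hu0, IsRoot.def] at hp't
  have hno : ∀ x ∈ Ioo p' b', ¬ (v.eval x = 0 ∨ V.eval x = 0) := by
    intro x hx h
    have : x ∈ s := by
      simp only [hs, Finset.mem_filter, hmem]; exact ⟨h, hpp'.trans_lt hx.1⟩
    exact (s.min'_le _ this).not_gt hx.2
  obtain ⟨z, hz, hz0⟩ := exists_zero_of_consecutive huv hVU hdec hp't.2 hp't.1 hb's.1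
    (fun x hx h => hno x hx (Or.inl h)) (fun x hx h => hno x hx (Or.inr h))
    (fun x hx h => by
      have : x ∈ t := by simp [ht, hu0, h, hx.2]
      exact (t.le_max' _ this).not_gt hx.1)
  exact ⟨z, hpp'.trans_lt hz.1, hz.2.trans_le hb'b, hz0⟩

/-! ### Three term recurrences, Wronskians and Christoffel-Darboux expressions. -/

/-- The three term recurrence `y_{n+2} = (X - b_{n+2}) y_{n+1} - a_{n+1} y_n`. -/
def ThreeTerm (a b : ℕ → ℝ) (y : ℕ → ℝ[X]) : Prop :=
  ∀ n, y (n + 2) = (X - C (b (n + 2))) * y (n + 1) - C (a (n + 1)) * y n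

/-- The solution of the recurrence with `y_0 = 1`, `y_1 = X - b_1`. -/
noncomputable def fstKind (a b : ℕ → ℝ) : ℕ → ℝ[X]
  | 0 => 1
  | 1 => X - C (b 1)
  | n + 2 => (X - C (b (n + 2))) * fstKind a b (n + 1) - C (a (n + 1)) * fstKind a b n

/-- The solution of the recurrence with `y_0 = 0`, `y_1 = 1`. -/
noncomputable def sndKind (a b : ℕ → ℝ) : ℕ → ℝ[X]
  | 0 => 0
  | 1 => 1
  | n + 2 => (X - C (b (n + 2))) * sndKind a b (n + 1) - C (a (n + 1)) * sndKind a b n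

variable {a b : ℕ → ℝ}

lemma threeTerm_fstKind : ThreeTerm a b (fstKind a b) := fun n => by rw [fstKind]

lemma threeTerm_sndKind : ThreeTerm a b (sndKind a b) := fun n => by rw [sndKind]

lemma ThreeTerm.combination {y z : ℕ → ℝ[X]} (hy : ThreeTerm a b y) (hz : ThreeTerm a b z)
    (A B : ℝ[X]) : ThreeTerm a b (fun n => y n * A - z n * B) := fun n => by
  simp only [hy n, hz n]; ring

lemma ThreeTerm.ext {y z : ℕ → ℝ[X]} (hy : ThreeTerm a b y) (hz : ThreeTerm a b z)
    (h0 : y 0 = z 0) (h1 : y 1 = z 1) (n : ℕ) : y n = z n := by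
  induction n using Nat.twoStepInduction with
  | zero => exact h0
  | one => exact h1
  | more n h h' => rw [hy, hz, h, h']

/-- The confluent Christoffel-Darboux step. -/
lemma ThreeTerm.christoffel_succ {y : ℕ → ℝ[X]} (hy : ThreeTerm a b y) (n : ℕ) :
    (y (n + 2)).derivative * y (n + 1) - y (n + 2) * (y (n + 1)).derivative =
      y (n + 1) ^ 2 + C (a (n + 1)) *
        ((y (n + 1)).derivative * y n - y (n + 1) * (y n).derivative) := by
  rw [hy n]
  simp only [derivative_sub, derivative_mul, derivative_X, derivative_C]
  ring

lemma ThreeTerm.wronskian {y z : ℕ → ℝ[X]} (hy : ThreeTerm a b y) (hz : ThreeTerm a b z) (n : ℕ) :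
    y n * z (n + 1) - y (n + 1) * z n =
      C (∏ i ∈ Finset.range n, a (i + 1)) * (y 0 * z 1 - y 1 * z 0) := by
  induction n with
  | zero => simp
  | succ n ih =>
    rw [Finset.prod_range_succ, C_mul]
    linear_combination (y (n + 1)) * (hz n) - (z (n + 1)) * (hy n) + C (a (n + 1)) * ih

lemma prod_coeff_pos (ha : ∀ n, 0 < a (n + 1)) (n : ℕ) :
    0 < ∏ i ∈ Finset.range n, a (i + 1) :=
  Finset.prod_pos fun i _ => ha i

lemma fst_mul_snd_sub (n : ℕ) :
    fstKind a b n * sndKind a b (n + 1) - fstKind a b (n + 1) * sndKind a b n =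
      C (∏ i ∈ Finset.range n, a (i + 1)) := by
  rw [threeTerm_fstKind.wronskian threeTerm_sndKind]
  simp [fstKind, sndKind]

lemma ThreeTerm.christoffel_nonneg (ha : ∀ n, 0 < a (n + 1)) {y : ℕ → ℝ[X]}
    (hy : ThreeTerm a b y) {x : ℝ}
    (h0 : (y 0).eval x ^ 2 ≤ ((y 1).derivative * y 0 - y 1 * (y 0).derivative).eval x) (n : ℕ) :
    (y n).eval x ^ 2 ≤
      ((y (n + 1)).derivative * y n - y (n + 1) * (y n).derivative).eval x := by
  induction n with
  | zero => exact h0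
  | succ n ih =>
    rw [hy.christoffel_succ, eval_add, eval_mul, eval_C, eval_pow]
    have := mul_nonneg (ha n).le ((sq_nonneg _).trans ih)
    linarith

lemma fst_christoffel_pos (ha : ∀ n, 0 < a (n + 1)) (n : ℕ) (x : ℝ) :
    0 < ((fstKind a b (n + 1)).derivative * fstKind a b n -
      fstKind a b (n + 1) * (fstKind a b n).derivative).eval x := by
  induction n with
  | zero => simp [fstKind]
  | succ n ih =>
    rw [threeTerm_fstKind.christoffel_succ, eval_add, eval_mul (p := C _), eval_C, eval_pow]
    have := mul_pos (ha n) ih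
    positivity

lemma snd_christoffel_pos (ha : ∀ n, 0 < a (n + 1)) (n : ℕ) (x : ℝ) :
    0 < ((sndKind a b (n + 2)).derivative * sndKind a b (n + 1) -
      sndKind a b (n + 2) * (sndKind a b (n + 1)).derivative).eval x := by
  induction n with
  | zero => simp [sndKind]
  | succ n ih =>
    rw [threeTerm_sndKind.christoffel_succ, eval_add, eval_mul (p := C _), eval_C, eval_pow]
    have := mul_pos (ha (n + 1)) ih
    positivity

/-- Freeze x and combine P_n and Q_n, with the constants Q_{m+1}(x) and P_{m+1}(x), into a solution
y vanishing at x for n = m + 1. Its Christoffel-Darboux expression at x reduces to y_{m+1}'(x)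
y_m(x) ≥ y_m(x)². Here y_m(x) is a Wronskian, hence positive, and y_{m+1}'(x) is the quantity in
question. -/
lemma fst_deriv_mul_snd_pos (ha : ∀ n, 0 < a (n + 1)) (m : ℕ) (x : ℝ) :
    0 < (fstKind a b (m + 1)).derivative.eval x * (sndKind a b (m + 1)).eval x -
      (fstKind a b (m + 1)).eval x * (sndKind a b (m + 1)).derivative.eval x := by
  set s := (sndKind a b (m + 1)).eval x
  set r := (fstKind a b (m + 1)).eval x
  have hy : ThreeTerm a b (fun n => fstKind a b n * C s - sndKind a b n * C r) :=
    threeTerm_fstKind.combination threeTerm_sndKind _ _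
  have hk := hy.christoffel_nonneg ha (x := x) (by simp [fstKind, sndKind]; nlinarith) m
  have hw := congrArg (eval x) (fst_mul_snd_sub (a := a) (b := b) m)
  have hp := prod_coeff_pos ha m
  simp only [eval_sub, eval_mul, eval_C, derivative_sub, derivative_mul, derivative_C,
    mul_zero, add_zero] at hk hw
  set c := ∏ i ∈ Finset.range m, a (i + 1)
  have e : (fstKind a b m).eval x * s - (sndKind a b m).eval x * r = c := by
    simp only [s, r]; linarith
  rw [e] at hk
  have e2 : (fstKind a b (m + 1)).eval x * s - (sndKind a b (m + 1)).eval x * r = 0 := by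
    simp only [s, r]; ring
  rw [e2] at hk
  have : 0 < c ^ 2 := by positivity
  by_contra! hc
  nlinarith

/-! ### Addition formula, reflected solution and existence of zeros for periodic data. -/

/-- The data of a recurrence which is periodic with period `M` up to the first step, where the
coefficient `a_1` is twice the periodic one. -/
structure PeriodicData (a b : ℕ → ℝ) (M : ℕ) (G : ℝ[X]) : Prop where
  pos : ∀ n, 0 < a (n + 1)
  one_le : 1 ≤ M
  per_b : ∀ n, 1 ≤ n → b (n + M) = b n
  per_a : ∀ n, 2 ≤ n → a (n + M) = a n
  two : a 1 = 2 * a (M + 1)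
  fst_succ : 2 * fstKind a b (M + 1) = fstKind a b 1 * fstKind a b M + G
  snd_succ : 2 * sndKind a b (M + 1) = fstKind a b M + fstKind a b 1 * sndKind a b M

namespace PeriodicData

variable {M : ℕ} {G : ℝ[X]}

/-- The addition formula. -/
lemma fst_add (h : PeriodicData a b M G) (j : ℕ) :
    2 * fstKind a b (M + (j + 1)) =
      fstKind a b M * fstKind a b (j + 1) + G * sndKind a b (j + 1) := by
  induction j using Nat.twoStepInduction with
  | zero => rw [zero_add, h.fst_succ]; simp [sndKind]; ring
  | one =>
    have e := threeTerm_fstKind (a := a) (b := b) M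
    have hb : b (M + 2) = b 2 := by rw [add_comm, h.per_b 2 (by norm_num)]
    -- At index 0 the formula fails by a factor 2, since P_M P_0 + G Q_0 = P_M. The relation a_1 =
    -- 2a_{M+1} compensates for this in the first recurrence step.
    have ha : C (a 1) = 2 * C (a (M + 1)) := by rw [h.two, C_mul]; rfl
    rw [hb] at e
    rw [show M + (1 + 1) = M + 2 from rfl, e, show (1 + 1 : ℕ) = 0 + 2 from rfl,
      threeTerm_fstKind 0, threeTerm_sndKind 0]
    simp only [zero_add, ha]
    have h1 := h.fst_succ
    simp only [fstKind, sndKind] at h1 ⊢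
    linear_combination (X - C (b 2)) * h1
  | more n h1 h2 =>
    have e := threeTerm_fstKind (a := a) (b := b) (M + (n + 1))
    have hb : b (M + (n + 1) + 2) = b (n + 1 + 2) := by
      rw [show M + (n + 1) + 2 = n + 1 + 2 + M by ring, h.per_b _ (by omega)]
    have ha : a (M + (n + 1) + 1) = a (n + 1 + 1) := by
      rw [show M + (n + 1) + 1 = n + 1 + 1 + M by ring, h.per_a _ (by omega)]
    rw [hb, ha] at e
    rw [show M + (n + 2 + 1) = M + (n + 1) + 2 by ring, e, show n + 2 + 1 = n + 1 + 2 by ring,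
      threeTerm_fstKind (n + 1), threeTerm_sndKind (n + 1)]
    simp only [← add_assoc] at *
    linear_combination (X - C (b (n + 1 + 2))) * h2 - C (a (n + 1 + 1)) * h1

/-- The reflected solution `P_M P_j - G Q_j`. -/
noncomputable def refl (a b : ℕ → ℝ) (M : ℕ) (G : ℝ[X]) (n : ℕ) : ℝ[X] :=
  fstKind a b n * fstKind a b M - sndKind a b n * G

lemma threeTerm_refl : ThreeTerm a b (refl a b M G) :=
  threeTerm_fstKind.combination threeTerm_sndKind _ _

/-- Eliminating P_M and G through `fst_succ` and `snd_succ` turns the reflected solution at M into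
twice the Wronskian of P and Q. The factor 2, absent at M + 1, decides the sign in
`refl_christoffel_neg`. -/
lemma refl_self (h : PeriodicData a b M G) :
    refl a b M G M = C (2 * ∏ i ∈ Finset.range M, a (i + 1)) := by
  have hw := fst_mul_snd_sub (a := a) (b := b) M
  have h1 := h.fst_succ
  have h2 := h.snd_succ
  rw [C_mul, ← hw, refl, show (C 2 : ℝ[X]) = 2 from rfl]
  linear_combination (sndKind a b M) * h1 - (fstKind a b M) * h2

lemma refl_succ (h : PeriodicData a b M G) :
    refl a b M G (M + 1) = fstKind a b 1 * C (∏ i ∈ Finset.range M, a (i + 1)) := by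
  have hw := h.refl_self
  have h1 := h.fst_succ
  have h2 := h.snd_succ
  rw [C_mul, refl, show (C 2 : ℝ[X]) = 2 from rfl] at hw
  have : (2 : ℝ[X]) ≠ 0 := two_ne_zero
  apply mul_left_cancel₀ this
  rw [refl]
  linear_combination (fstKind a b M) * h1 - G * h2 + (fstKind a b 1) * hw

/-- The Christoffel-Darboux expressions of the reflected solution are negative. -/
lemma refl_christoffel_neg (h : PeriodicData a b M G) (x : ℝ) {j : ℕ} (hj : j < M) :
    ((refl a b M G (j + 1)).derivative * refl a b M G j -
      refl a b M G (j + 1) * (refl a b M G j).derivative).eval x < 0 := by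
  have step : ∀ n, 0 < a (n + 1) := h.pos
  -- Downward induction on j. With W_j the Christoffel-Darboux expression, the recursion reads
  -- a_{j+1} W_j = W_{j+1} - r_{j+1}². At the start r_M = 2c and W_M = 2c² for the constant c of the
  -- Wronskian, so a_M W_{M-1} = -2c².
  have key : ∀ k j, j + 1 + k = M → ((refl a b M G (j + 1)).derivative * refl a b M G j -
      refl a b M G (j + 1) * (refl a b M G j).derivative).eval x < 0 := by
    intro k
    induction k with
    | zero =>
      intro j hj
      have e := congrArg (eval x) ((threeTerm_refl (a := a) (b := b) (M := M) (G := G)).christoffel_succ j)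
      have hM : j + 1 = M := by omega
      rw [eval_add, eval_mul (p := C _), eval_C, show j + 2 = M + 1 by omega] at e
      rw [hM] at e ⊢
      have hc := prod_coeff_pos step M
      simp only [h.refl_self, h.refl_succ, fstKind] at e ⊢
      simp only [derivative_mul, derivative_sub, derivative_X, derivative_C, eval_sub, eval_mul,
        eval_add, eval_C, eval_X, eval_one, eval_zero, eval_pow] at e ⊢
      set c := ∏ i ∈ Finset.range M, a (i + 1)
      have : 0 < c ^ 2 := by positivity
      have ha : 0 < a M := hM ▸ step j
      by_contra! hn
      have := mul_nonneg ha.le hn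
      nlinarith
    | succ k ih =>
      intro j hj
      have e := congrArg (eval x) ((threeTerm_refl (a := a) (b := b) (M := M) (G := G)).christoffel_succ j)
      rw [eval_add, eval_mul (p := C _), eval_C, eval_pow] at e
      have h1 := ih (j + 1) (by omega)
      rw [show j + 1 + 1 = j + 2 by rfl, e] at h1
      have := sq_nonneg ((refl a b M G (j + 1)).eval x)
      exact neg_of_mul_neg_right (by linarith) (step j).le
  exact key (M - (j + 1)) j (by omega)

lemma fst_wronskian_refl (j : ℕ) :
    fstKind a b (j + 1) * refl a b M G j - fstKind a b j * refl a b M G (j + 1) =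
      C (∏ i ∈ Finset.range j, a (i + 1)) * G := by
  rw [← fst_mul_snd_sub (a := a) (b := b) j, refl, refl]; ring

lemma snd_wronskian_refl (j : ℕ) :
    sndKind a b (j + 1) * refl a b M G j - sndKind a b j * refl a b M G (j + 1) =
      C (∏ i ∈ Finset.range j, a (i + 1)) * fstKind a b M := by
  rw [← fst_mul_snd_sub (a := a) (b := b) j, refl, refl]; ring

/-- If `y_{n+1} / y_n` increases, `r_{n+1} / r_n` decreases and `c V` is the Wronskian of `y` and `r`,
then `y_n r_n / V` decreases. -/
lemma product_div_wronskian_deriv_neg {y y' r r' V : ℝ[X]} {c x : ℝ} (hc : 0 < c)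
    (hV : y' * r - y * r' = C c * V) (hV0 : V.eval x ≠ 0)
    (hy : 0 < (y'.derivative * y - y' * y.derivative).eval x)
    (hr : (r'.derivative * r - r' * r.derivative).eval x < 0) :
    (y * r).derivative.eval x * V.eval x - (y * r).eval x * V.derivative.eval x < 0 := by
  have e0 := congrArg (eval x) hV
  have e1 := congrArg (fun p => eval x (derivative p)) hV
  simp only [derivative_mul, derivative_sub, derivative_C, eval_sub, eval_mul,
    eval_add, eval_C, zero_mul, zero_add] at e0 e1 hy hr ⊢
  refine neg_of_mul_neg_right (?_ : c * _ < 0) hc.le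
  set Y := eval x y
  set Y' := eval x y'
  set R := eval x r
  set R' := eval x r'
  set dY := eval x (derivative y)
  set dY' := eval x (derivative y')
  set dR := eval x (derivative r)
  set dR' := eval x (derivative r')
  -- Dividing `hV` by yr gives cV/(yr) = y'/y - r'/r (primes name the next terms), a difference of
  -- an increasing and a decreasing quotient. This is its derivative with denominators cleared, so
  -- that zeros of y and r are allowed.
  have e : c * ((dY * R + Y * dR) * V.eval x - Y * R * V.derivative.eval x) =
      -((dY' * Y - Y' * dY) * R ^ 2) + (dR' * R - R' * dR) * Y ^ 2 := by
    linear_combination (-(dY * R + Y * dR)) * e0 + Y * R * e1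
  rw [e]
  by_cases hR : R = 0
  · have hY : Y ≠ 0 := by
      intro h
      apply hV0
      have : c * eval x V = 0 := by rw [← e0, h, hR]; ring
      simpa [hc.ne'] using this
    have : 0 < Y ^ 2 := by positivity
    rw [hR] at hr ⊢
    nlinarith
  · have : 0 < R ^ 2 := by positivity
    nlinarith [mul_pos hy this, sq_nonneg Y]

/-- `G / P_M` is strictly increasing. -/
lemma deriv_mul_fst_pos (h : PeriodicData a b M G) (x : ℝ) :
    0 < G.derivative.eval x * (fstKind a b M).eval x -
      G.eval x * (fstKind a b M).derivative.eval x := by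
  have hG : G = 2 * fstKind a b (M + 1) - fstKind a b 1 * fstKind a b M := by
    rw [h.fst_succ]; ring
  obtain ⟨m, rfl⟩ : ∃ m, M = m + 1 := ⟨M - 1, by have := h.one_le; omega⟩
  have e := congrArg (eval x) ((threeTerm_fstKind (a := a) (b := b)).christoffel_succ m)
  have h1 := mul_pos (h.pos m) (fst_christoffel_pos (b := b) h.pos m x)
  rw [eval_add, eval_mul (p := C _), eval_C, eval_pow] at e
  simp only [eval_sub, eval_mul] at e h1
  have e2 : G.derivative.eval x * (fstKind a b (m + 1)).eval x -
      G.eval x * (fstKind a b (m + 1)).derivative.eval x =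
      2 * ((fstKind a b (m + 2)).derivative.eval x * (fstKind a b (m + 1)).eval x -
        (fstKind a b (m + 2)).eval x * (fstKind a b (m + 1)).derivative.eval x) -
        (fstKind a b (m + 1)).eval x ^ 2 := by
    have hd : derivative (2 : ℝ[X]) = 0 := derivative_ofNat 2
    have hf : fstKind a b 1 = X - C (b 1) := by rw [fstKind]
    rw [hG, hf]
    simp only [derivative_mul, derivative_sub, derivative_X, derivative_C, hd, eval_sub, eval_mul,
      eval_add, eval_C, eval_X, eval_ofNat, sub_zero, one_mul, zero_mul, zero_add]
    ring
  rw [e2, e]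
  nlinarith [sq_nonneg ((fstKind a b (m + 1)).eval x)]

/-- This is the case u = P_j, v = Q_j, U = P_M, V = G, where uU - vV is the reflected solution and
uU + vV = 2P_{M+j}. -/
lemma exists_zero_of_fst_zero (h : PeriodicData a b M G) {j : ℕ} (hj : j + 1 < M) {p c : ℝ}
    (hpc : p < c) (hp : (fstKind a b (j + 1)).eval p = 0)
    (hc : (sndKind a b (j + 1)).eval c = 0 ∨ G.eval c = 0) :
    ∃ z, p < z ∧ z < c ∧ (fstKind a b (M + (j + 1))).eval z = 0 := by
  obtain ⟨z, h1, h2, h3⟩ := exists_zero_between (U := fstKind a b M) (V := G)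
    (fst_deriv_mul_snd_pos h.pos j) h.deriv_mul_fst_pos
    (fun x hx => product_div_wronskian_deriv_neg (prod_coeff_pos h.pos (j + 1))
      (fst_wronskian_refl (j + 1)) hx (fst_christoffel_pos h.pos (j + 1) x)
      (h.refl_christoffel_neg x hj)) hpc hp hc
  refine ⟨z, h1, h2, ?_⟩
  have := congrArg (eval z) (h.fst_add j)
  rw [h3] at this
  simpa using this

/-- This is the case u = Q_j, v = -P_j, U = G, V = -P_M. The signs keep the quotients increasing and
the sum equal to 2P_{M+j}; u(uU - vV)/V becomes Q_j r_j / P_M. -/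
lemma exists_zero_of_snd_zero (h : PeriodicData a b M G) {j : ℕ} (hj : j + 1 < M) {q c : ℝ}
    (hqc : q < c) (hq : (sndKind a b (j + 1)).eval q = 0)
    (hc : (fstKind a b (j + 1)).eval c = 0 ∨ (fstKind a b M).eval c = 0) :
    ∃ z, q < z ∧ z < c ∧ (fstKind a b (M + (j + 1))).eval z = 0 := by
  obtain ⟨z, h1, h2, h3⟩ := exists_zero_between (u := sndKind a b (j + 1))
    (v := -fstKind a b (j + 1)) (U := G) (V := -fstKind a b M)
    (fun x => by
      have := fst_deriv_mul_snd_pos (b := b) h.pos j x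
      simp only [derivative_neg, eval_neg]; linarith)
    (fun x => by
      have := h.deriv_mul_fst_pos x
      simp only [derivative_neg, eval_neg]; linarith)
    (fun x hx => by
      have hx' : (fstKind a b M).eval x ≠ 0 := by simpa using hx
      have := product_div_wronskian_deriv_neg (prod_coeff_pos h.pos (j + 1))
        (snd_wronskian_refl (G := G) (M := M) (b := b) (j + 1)) hx' (snd_christoffel_pos h.pos j x)
        (h.refl_christoffel_neg x hj)
      have e : sndKind a b (j + 1) * (sndKind a b (j + 1) * G -
          -fstKind a b (j + 1) * -fstKind a b M) =
          -(sndKind a b (j + 1) * refl a b M G (j + 1)) := by rw [refl]; ring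
      rw [e]
      simp only [derivative_neg, eval_neg]
      linarith) hqc hq (by simpa using hc)
  refine ⟨z, h1, h2, ?_⟩
  have := congrArg (eval z) (h.fst_add j)
  rw [show fstKind a b M * fstKind a b (j + 1) + G * sndKind a b (j + 1) =
    G * sndKind a b (j + 1) + -fstKind a b M * -fstKind a b (j + 1) by ring, h3] at this
  simpa using this

end PeriodicData

/-! ### Integrability of inverse square root singularities. -/

section Integrability

/-- The sum of |t^{-1/2}| and |(-t)^{-1/2}| dominates on both sides of 0, whatever the real power
means at negative arguments. -/
lemma intervalIntegrable_sqrt_inv_abs (A B : ℝ) :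
    IntervalIntegrable (fun t : ℝ => √(|t|⁻¹)) volume A B := by
  have h1 : ∀ A B : ℝ, IntervalIntegrable (fun t : ℝ => t ^ (-(1 / 2) : ℝ)) volume A B :=
    fun A B => intervalIntegral.intervalIntegrable_rpow' (by norm_num)
  have h2 : IntervalIntegrable (fun t : ℝ => (-t) ^ (-(1 / 2) : ℝ)) volume A B := by
    simpa using (IntervalIntegrable.iff_comp_neg (by simp)).mp (h1 (-A) (-B))
  refine ((h1 A B).norm.add h2.norm).mono_fun ?_ (ae_of_all _ fun t => ?_)
  · exact (Real.continuous_sqrt.measurable.comp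
      (measurable_norm.inv : Measurable fun t : ℝ => ‖t‖⁻¹)).aestronglyMeasurable
  · have key : ∀ x : ℝ, 0 ≤ x → √(x⁻¹) = x ^ (-(1 / 2) : ℝ) := fun x hx => by
      rw [Real.sqrt_inv, Real.rpow_neg hx, Real.sqrt_eq_rpow]
    have hpos : 0 ≤ |t ^ (-(1 / 2) : ℝ)| + |(-t) ^ (-(1 / 2) : ℝ)| := by positivity
    beta_reduce
    rw [Real.norm_eq_abs, abs_of_nonneg (Real.sqrt_nonneg _), Real.norm_eq_abs,
      Real.norm_eq_abs, Real.norm_eq_abs, abs_of_nonneg hpos, key _ (abs_nonneg _)]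
    rcases le_total 0 t with h | h
    · rw [abs_of_nonneg h]
      exact (le_abs_self _).trans (le_add_of_nonneg_right (abs_nonneg _))
    · rw [abs_of_nonpos h]
      exact (le_abs_self _).trans (le_add_of_nonneg_left (abs_nonneg _))

lemma sqrt_sum_le {ι : Type*} (s : Finset ι) (f : ι → ℝ) (hf : ∀ i ∈ s, 0 ≤ f i) :
    √(∑ i ∈ s, f i) ≤ ∑ i ∈ s, √(f i) := by
  classical
  induction s using Finset.induction_on with
  | empty => simp
  | insert i s hi ih =>
    rw [Finset.sum_insert hi, Finset.sum_insert hi]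
    have h1 : 0 ≤ f i := hf i (by simp)
    have h2 : 0 ≤ ∑ j ∈ s, f j := Finset.sum_nonneg fun j hj => hf j (by simp [hj])
    refine le_trans ?_ (add_le_add_right (ih fun j hj => hf j (by simp [hj])) _)
    rw [Real.sqrt_le_left (by positivity)]
    nlinarith [Real.sq_sqrt h1, Real.sq_sqrt h2, Real.sqrt_nonneg (f i),
      Real.sqrt_nonneg (∑ j ∈ s, f j),
      mul_nonneg (Real.sqrt_nonneg (f i)) (Real.sqrt_nonneg (∑ j ∈ s, f j))]

/-- The inverse square root of a polynomial with simple zeros is locally integrable. -/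
lemma intervalIntegrable_sqrt_inv_prod (s : Finset ℝ) (A B : ℝ) :
    IntervalIntegrable (fun t : ℝ => √((∏ e ∈ s, |t - e|)⁻¹)) volume A B := by
  classical
  have hmeas : Measurable fun t : ℝ => √((∏ e ∈ s, |t - e|)⁻¹) :=
    Real.continuous_sqrt.measurable.comp (Measurable.inv
      (Continuous.measurable (by fun_prop)))
  rcases s.eq_empty_or_nonempty with rfl | hs
  · simp
  -- Partial fractions: interpolating the constant 1 at the points of s gives 1/∏(t - e) = Σ c_e/(t
  -- - e). Subadditivity of the square root then reduces to one singularity at a time.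
  set c := Lagrange.nodalWeight s id
  have hint : IntervalIntegrable (fun t : ℝ => ∑ e ∈ s, √|c e| * √(|t - e|⁻¹)) volume A B := by
    have := IntervalIntegrable.sum s (f := fun e t => √|c e| * √(|t - e|⁻¹)) (a := A) (b := B)
      (μ := volume) fun e _ => by
        have := (intervalIntegrable_sqrt_inv_abs (A - e) (B - e)).comp_sub_right e
        rw [sub_add_cancel, sub_add_cancel] at this
        exact this.const_mul _
    simpa only [Finset.sum_fn] using this
  refine hint.mono_fun hmeas.aestronglyMeasurable (ae_of_all _ fun t => ?_)
  beta_reduce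
  rw [Real.norm_eq_abs, Real.norm_eq_abs, abs_of_nonneg (Real.sqrt_nonneg _),
    abs_of_nonneg (Finset.sum_nonneg fun e _ => by positivity)]
  by_cases ht : ∀ e ∈ s, t ≠ id e
  · have h1 := Lagrange.eval_interpolate_not_at_node (s := s) (v := id) (1 : ℝ → ℝ) ht
    rw [Lagrange.interpolate_one (injOn_id _) hs, Lagrange.eval_nodal] at h1
    simp only [eval_one, Pi.one_apply, mul_one, id] at h1
    have hP : ∏ e ∈ s, (t - e) ≠ 0 := fun h => by simp [h] at h1
    have h2 : (∏ e ∈ s, |t - e|)⁻¹ = |∑ e ∈ s, c e * (t - e)⁻¹| := by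
      rw [← Finset.abs_prod, ← abs_inv]
      congr 1
      exact inv_eq_of_mul_eq_one_right h1.symm
    rw [h2]
    calc √|∑ e ∈ s, c e * (t - e)⁻¹| ≤ √(∑ e ∈ s, |c e| * |t - e|⁻¹) := by
          refine Real.sqrt_le_sqrt ((Finset.abs_sum_le_sum_abs _ _).trans_eq ?_)
          exact Finset.sum_congr rfl fun e _ => by rw [abs_mul, abs_inv]
      _ ≤ ∑ e ∈ s, √(|c e| * |t - e|⁻¹) := sqrt_sum_le _ _ fun e _ => by positivity
      _ = _ := Finset.sum_congr rfl fun e _ => Real.sqrt_mul (abs_nonneg _) _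
  · push Not at ht
    obtain ⟨e, he, rfl⟩ := ht
    -- At a singular point the convention 0⁻¹ = 0 makes the left side 0.
    rw [Finset.prod_eq_zero he (by simp), inv_zero, Real.sqrt_zero]
    exact Finset.sum_nonneg fun e _ => by positivity

end Integrability

/-! ### Positivity and integrability of the weight. -/

variable {g : ℕ} {α β : Fin g → ℝ}

/-- The points where the weight is infinite. -/
noncomputable def poles (β : Fin g → ℝ) : Finset ℝ := {1, -1} ∪ Finset.univ.image β

/-- The end points of the components of `E`. -/
def ends (α β : Fin g → ℝ) : Set ℝ := {1, -1} ∪ range α ∪ range β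

lemma finite_ends : (ends α β).Finite :=
  (((finite_singleton _).insert _).union (finite_range _)).union (finite_range _)

lemma ae_notMem_ends : ∀ᵐ t : ℝ, t ∉ ends α β := by
  have := finite_ends (α := α) (β := β) |>.measure_zero volume
  exact measure_eq_zero_iff_ae_notMem.mp this

namespace IsGapSystem

lemma beta_injective (h : IsGapSystem α β) : Function.Injective β := by
  intro i k hik
  rcases lt_trichotomy i k with hlt | heq | hlt
  · have := h.2 i k hlt; have := (h.1 k).2.1; linarith
  · exact heq
  · have := h.2 k i hlt; have := (h.1 i).2.1; linarith

lemma prod_poles (h : IsGapSystem α β) (f : ℝ → ℝ) :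
    ∏ e ∈ poles β, f e = f 1 * f (-1) * ∏ i, f (β i) := by
  classical
  rw [poles, Finset.prod_union, Finset.prod_pair (by norm_num),
    Finset.prod_image fun i _ k _ hik => h.beta_injective hik]
  rw [Finset.disjoint_left]
  intro x hx hx'
  obtain ⟨i, -, rfl⟩ := Finset.mem_image.mp hx'
  have := h.1 i
  rcases Finset.mem_insert.mp hx with h1 | h1
  · linarith
  · have := Finset.mem_singleton.mp h1; linarith

lemma measurableSet_E : MeasurableSet (E α β) :=
  measurableSet_Icc.diff (MeasurableSet.iUnion fun _ => measurableSet_Ioo)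

lemma measurable_w : Measurable (w α β) := by
  unfold w
  fun_prop

lemma factor_pos (h : IsGapSystem α β) {t : ℝ} (ht' : t ∉ ends α β) {i : Fin g}
    (ht : t ∉ Ioo (α i) (β i)) : 0 < (t - α i) / (t - β i) := by
  simp only [ends, mem_union, mem_range, not_or, not_exists] at ht'
  have h2 : t ≠ α i := fun h => ht'.1.2 i h.symm
  have h3 : t ≠ β i := fun h => ht'.2 i h.symm
  have h4 := (h.1 i).2.1
  rcases lt_or_gt_of_ne h2 with h | h
  · exact div_pos_of_neg_of_neg (by linarith) (by linarith)
  · have : β i < t := lt_of_le_of_ne (not_lt.mp fun h' => ht ⟨h, h'⟩) h3.symm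
    exact div_pos (by linarith) (by linarith)

lemma w_eq (α β : Fin g → ℝ) (t : ℝ) :
    w α β t = 1 / Real.pi * √((1 - t ^ 2)⁻¹ * ∏ i, (t - α i) / (t - β i)) := by
  rw [w, Finset.prod_div_distrib]
  congr 2
  rw [← div_div, div_eq_mul_inv _ (1 - t ^ 2), mul_comm, mul_div_assoc, mul_comm]

lemma notMem_gap {t : ℝ} (ht : t ∈ E α β) (i : Fin g) : t ∉ Ioo (α i) (β i) := by
  exact fun hi => ht.2 (mem_iUnion.mpr ⟨i, hi⟩)

lemma mem_Ioo_of_mem_E {t : ℝ} (ht : t ∈ E α β) (ht' : t ∉ ends α β) : t ∈ Ioo (-1) 1 := by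
  have h1 := ht.1
  refine ⟨lt_of_le_of_ne h1.1 ?_, lt_of_le_of_ne h1.2 ?_⟩
  · rintro rfl; exact ht' (by simp [ends])
  · rintro rfl; exact ht' (by simp [ends])

lemma w_pos (h : IsGapSystem α β) {t : ℝ} (ht : t ∈ E α β) (ht' : t ∉ ends α β) :
    0 < w α β t := by
  have h1 := mem_Ioo_of_mem_E ht ht'
  have h2 : 0 < 1 - t ^ 2 := by nlinarith [h1.1, h1.2]
  have h3 : 0 < ∏ i, (t - α i) / (t - β i) :=
    Finset.prod_pos fun i _ => h.factor_pos ht' (notMem_gap ht i)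
  rw [w_eq]
  have := Real.pi_pos
  positivity

lemma w_nonneg (t : ℝ) : 0 ≤ w α β t := by
  have := Real.pi_pos
  unfold w
  positivity

/-- On E each |t - α_i| is at most 2 and 1/π ≤ 1, so √(2^g) times the inverse square root of the
product over the poles dominates the weight. -/
lemma integrableOn_w (h : IsGapSystem α β) : IntegrableOn (w α β) (E α β) := by
  have hint := (intervalIntegrable_sqrt_inv_prod (poles β) (-1) 1).1
  rw [← integrableOn_Icc_iff_integrableOn_Ioc] at hint
  have hint' := (hint.mono_set (t := Icc (-1) 1) (s := E α β) sdiff_subset).const_mul (√(2 ^ g))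
  refine Integrable.mono' hint' measurable_w.aestronglyMeasurable ?_
  refine (ae_restrict_iff' measurableSet_E).mpr (ae_of_all _ fun t ht => ?_)
  have h1 : |t| ≤ 1 := abs_le.mpr ht.1
  rw [Real.norm_eq_abs, abs_of_nonneg (w_nonneg t), w, h.prod_poles (fun e => |t - e|),
    ← Real.sqrt_mul (by positivity)]
  refine (mul_le_of_le_one_left (Real.sqrt_nonneg _) ?_).trans (Real.sqrt_le_sqrt ?_)
  · rw [div_le_one Real.pi_pos]; linarith [Real.pi_gt_three]
  · refine (le_abs_self _).trans ?_
    rw [abs_div, abs_mul, Finset.abs_prod, Finset.abs_prod, div_eq_mul_inv,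
      show 1 - t ^ 2 = -((t - 1) * (t - -1)) by ring, abs_neg, abs_mul]
    refine mul_le_mul_of_nonneg_right ?_ (by positivity)
    have : ∏ i, |t - α i| ≤ ∏ _i : Fin g, (2 : ℝ) := by
      refine Finset.prod_le_prod (fun _ _ => abs_nonneg _) fun i _ => ?_
      have := h.1 i
      have h3 := abs_le.mp h1
      rw [abs_le]; constructor <;> linarith
    simpa using this

lemma integrableOn_mul_w (h : IsGapSystem α β) {f : ℝ → ℝ} (hf : ContinuousOn f (Icc (-1) 1)) :
    IntegrableOn (fun t => f t * w α β t) (E α β) := by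
  obtain ⟨C, hC⟩ := isCompact_Icc.exists_bound_of_continuousOn hf
  have hE : E α β ⊆ Icc (-1) 1 := sdiff_subset
  refine Integrable.bdd_mul (c := C) h.integrableOn_w
    ((hf.mono hE).aestronglyMeasurable measurableSet_E) ?_
  exact (ae_restrict_iff' measurableSet_E).mpr (ae_of_all _ fun t ht => hC t (hE ht))

/-- The leftmost component of E is a nondegenerate interval starting at -1; inserting 1 among the
α_i covers the case of no gaps. -/
lemma volume_E_pos (h : IsGapSystem α β) : 0 < volume (E α β) := by
  obtain ⟨c, hc1, hc⟩ : ∃ c : ℝ, -1 < c ∧ Ioo (-1) c ⊆ E α β := by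
    classical
    set s : Finset ℝ := insert 1 (Finset.univ.image α) with hs
    have hne : s.Nonempty := ⟨1, by simp [hs]⟩
    refine ⟨s.min' hne, ?_, fun t ht => ⟨⟨ht.1.le, ?_⟩, fun hU => ?_⟩⟩
    · rw [Finset.lt_min'_iff]
      intro y hy
      simp only [hs, Finset.mem_insert, Finset.mem_image, Finset.mem_univ, true_and] at hy
      rcases hy with rfl | ⟨i, rfl⟩
      · norm_num
      · exact (h.1 i).1
    · exact ht.2.le.trans (s.min'_le _ (by simp [hs]))
    · obtain ⟨i, hi⟩ := mem_iUnion.mp hU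
      exact absurd (ht.2.trans_le (s.min'_le (α i) (by simp [hs]))) hi.1.not_gt
  refine lt_of_lt_of_le ?_ (measure_mono hc)
  rw [Real.volume_Ioo]
  simp only [ENNReal.ofReal_pos]
  linarith

/-- Positive definiteness of the inner product. -/
lemma integral_sq_mul_w_pos (h : IsGapSystem α β) {p : ℝ[X]} (hp : p ≠ 0) :
    0 < ∫ t in E α β, p.eval t * p.eval t * w α β t := by
  have hint : IntegrableOn (fun t => p.eval t * p.eval t * w α β t) (E α β) :=
    h.integrableOn_mul_w (p.continuous.mul p.continuous).continuousOn
  rw [setIntegral_pos_iff_support_of_nonneg_ae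
    (ae_of_all _ fun t => mul_nonneg (mul_self_nonneg _) (w_nonneg t)) hint]
  have hroots : volume {t | p.eval t = 0} = 0 := by
    have := (p.roots.toFinset.finite_toSet).measure_zero (volume : Measure ℝ)
    convert this using 2
    ext t; simp [hp]
  have hsub : E α β ⊆ (Function.support (fun t => p.eval t * p.eval t * w α β t) ∩ E α β) ∪
      ({t | p.eval t = 0} ∪ ends α β) := by
    intro t ht
    by_cases h1 : p.eval t = 0
    · exact Or.inr (Or.inl h1)
    by_cases h2 : t ∈ ends α β
    · exact Or.inr (Or.inr h2)
    · refine Or.inl ⟨?_, ht⟩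
      exact mul_ne_zero (mul_ne_zero h1 h1) (h.w_pos ht h2).ne'
  by_contra hc
  have hc' := nonpos_iff_eq_zero.mp (not_lt.mp hc)
  have := measure_mono_null hsub (measure_union_null hc'
    (measure_union_null hroots (finite_ends.measure_zero _)))
  exact h.volume_E_pos.ne' this

end IsGapSystem

/-! ### The branch of the square root on the closed upper half plane. -/

/-- The principal branch of the square root, with the value `1` at the origin. -/
noncomputable def csqrt (z : ℂ) : ℂ := Complex.exp (Complex.log z / 2)

lemma csqrt_ne_zero (z : ℂ) : csqrt z ≠ 0 := Complex.exp_ne_zero _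

lemma norm_csqrt {z : ℂ} (hz : z ≠ 0) : ‖csqrt z‖ = √‖z‖ := by
  have h : 0 < ‖z‖ := norm_pos_iff.mpr hz
  rw [csqrt, Complex.norm_exp, Complex.div_ofNat_re, Complex.log_re, Real.exp_half, Real.exp_log h]

lemma csqrt_ofReal_pos {x : ℝ} (hx : 0 < x) : csqrt x = (√x : ℝ) := by
  rw [csqrt, ← Complex.ofReal_log hx.le, ← Complex.ofReal_ofNat, ← Complex.ofReal_div,
    ← Complex.ofReal_exp, Real.exp_half, Real.exp_log hx]

lemma csqrt_ofReal_neg {x : ℝ} (hx : x < 0) : csqrt x = Complex.I * (√(-x) : ℝ) := by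
  have h1 : Complex.log (x : ℂ) = Complex.log ((-x : ℝ) : ℂ) + Real.pi * Complex.I := by
    rw [← Complex.ofReal_log (show (0 : ℝ) ≤ -x by linarith)]
    apply Complex.ext
    · simp [Complex.log_re]
    · rw [Complex.log_im, Complex.arg_ofReal_of_neg hx]
      simp
  rw [csqrt, h1, add_div, Complex.exp_add, mul_comm, ← csqrt_ofReal_pos (by linarith), csqrt]
  congr 1
  rw [mul_div_right_comm, Complex.exp_pi_div_two_mul_I]

lemma differentiableAt_csqrt {z : ℂ} (hz : z ∈ Complex.slitPlane) : DifferentiableAt ℂ csqrt z := by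
  unfold csqrt
  exact ((differentiableAt_id.clog hz).div_const 2).cexp

/-- The principal logarithm is continuous up to the negative axis from above, so boundary values
from the upper half plane exist despite the cut. -/
lemma continuousWithinAt_csqrt {z : ℂ} (hz : z ≠ 0) :
    ContinuousWithinAt csqrt {z | 0 ≤ z.im} z := by
  by_cases h : z ∈ Complex.slitPlane
  · exact (differentiableAt_csqrt h).continuousAt.continuousWithinAt
  · rw [Complex.mem_slitPlane_iff, not_or, not_lt, not_not] at h
    have hre : z.re < 0 := lt_of_le_of_ne h.1 fun h0 => hz (Complex.ext h0 h.2)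
    exact ((Complex.continuousWithinAt_log_of_re_neg_of_im_zero hre h.2).div_const 2).cexp

variable (α β)

/-- The analytic square root of `∏ (z - α i) / ((z² - 1) ∏ (z - β i))` on the upper half plane. -/
noncomputable def rootS (z : ℂ) : ℂ :=
  (csqrt (z - (1 : ℝ)) * csqrt (z - (-1 : ℝ)))⁻¹ *
    ∏ i, csqrt (z - (α i : ℝ)) / csqrt (z - (β i : ℝ))

variable {α β}

lemma differentiableAt_rootS (h : IsGapSystem α β) {z : ℂ} (hz : 0 < z.im ∨ 1 < z.re) :
    DifferentiableAt ℂ (rootS α β) z := by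
  have key : ∀ e : ℝ, e ≤ 1 → DifferentiableAt ℂ (fun z : ℂ => csqrt (z - (e : ℝ))) z := by
    intro e he
    refine DifferentiableAt.comp (g := csqrt) z (differentiableAt_csqrt ?_) (by fun_prop)
    rw [Complex.mem_slitPlane_iff]
    rcases hz with hz | hz
    · right; simpa using hz.ne'
    · left; simp only [Complex.sub_re, Complex.ofReal_re]; linarith
  unfold rootS
  refine DifferentiableAt.mul (DifferentiableAt.inv ((key 1 le_rfl).mul (key (-1) (by norm_num)))
    (mul_ne_zero (csqrt_ne_zero _) (csqrt_ne_zero _))) ?_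
  refine DifferentiableAt.fun_finsetProd fun i _ => ?_
  have := h.1 i
  exact (key _ (by linarith)).div (key _ (by linarith)) (csqrt_ne_zero _)

lemma continuousWithinAt_rootS {z : ℂ}
    (hz : ∀ e ∈ ends α β, z ≠ (e : ℝ)) :
    ContinuousWithinAt (rootS α β) {z | 0 ≤ z.im} z := by
  have key : ∀ e ∈ ends α β, ContinuousWithinAt (fun z : ℂ => csqrt (z - (e : ℝ)))
      {z | 0 ≤ z.im} z := by
    intro e he
    refine ContinuousWithinAt.comp (g := csqrt) (t := {z | 0 ≤ z.im})
      (continuousWithinAt_csqrt (sub_ne_zero.mpr (hz e he))) (by fun_prop) ?_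
    intro y hy
    simpa using hy
  unfold rootS
  refine ContinuousWithinAt.mul (ContinuousWithinAt.inv₀ ((key 1 ?_).mul (key (-1) ?_))
    (mul_ne_zero (csqrt_ne_zero _) (csqrt_ne_zero _))) ?_
  · simp [ends]
  · simp [ends]
  · refine tendsto_finsetProd _ fun i _ => ?_
    exact (key _ (by simp [ends])).div (key _ (by simp [ends])) (csqrt_ne_zero _)

lemma norm_rootS {z : ℂ} (hz : ∀ e ∈ ends α β, z ≠ (e : ℝ)) :
    ‖rootS α β z‖ = √((∏ i, ‖z - (α i : ℝ)‖) *
      (‖z - (1 : ℝ)‖ * ‖z - (-1 : ℝ)‖ * ∏ i, ‖z - (β i : ℝ)‖)⁻¹) := by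
  have hn : ∀ e ∈ ends α β, ‖csqrt (z - (e : ℝ))‖ = √‖z - (e : ℝ)‖ :=
    fun e he => norm_csqrt (sub_ne_zero.mpr (hz e he))
  rw [rootS, norm_mul, norm_inv, norm_mul, norm_prod, hn 1 (by simp [ends]),
    hn (-1) (by simp [ends]), Real.sqrt_mul (Finset.prod_nonneg fun i _ => norm_nonneg _),
    Real.sqrt_inv, Real.sqrt_mul (by positivity), Real.sqrt_mul (by positivity),
    Real.sqrt_prod _ fun i _ => norm_nonneg _, Real.sqrt_prod _ fun i _ => norm_nonneg _]
  have : ∏ i, ‖csqrt (z - (α i : ℝ)) / csqrt (z - (β i : ℝ))‖ =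
      (∏ i, √‖z - (α i : ℝ)‖) / ∏ i, √‖z - (β i : ℝ)‖ := by
    rw [← Finset.prod_div_distrib]
    refine Finset.prod_congr rfl fun i _ => ?_
    rw [norm_div, hn _ (by simp [ends]), hn _ (by simp [ends])]
  rw [this, mul_inv, div_eq_mul_inv]
  ring

/-- Boundary values of the quotient of two square roots off the gap. -/
lemma csqrt_div_csqrt_of_pos {x y : ℝ} (h : 0 < x / y) :
    csqrt x / csqrt y = (√(x / y) : ℝ) := by
  rcases (div_pos_iff.mp h) with ⟨hx, hy⟩ | ⟨hx, hy⟩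
  · rw [csqrt_ofReal_pos hx, csqrt_ofReal_pos hy, Real.sqrt_div hx.le, Complex.ofReal_div]
  · rw [csqrt_ofReal_neg hx, csqrt_ofReal_neg hy, mul_div_mul_left _ _ Complex.I_ne_zero,
      ← neg_div_neg_eq x y, Real.sqrt_div (by linarith), Complex.ofReal_div]

lemma prod_csqrt_div_of_pos {t : ℝ} (s : Finset (Fin g))
    (h : ∀ i ∈ s, 0 < (t - α i) / (t - β i)) :
    ∏ i ∈ s, csqrt ((t : ℂ) - (α i : ℝ)) / csqrt ((t : ℂ) - (β i : ℝ)) =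
      ((√(∏ i ∈ s, (t - α i) / (t - β i)) : ℝ) : ℂ) := by
  rw [Real.sqrt_prod _ fun i hi => (h i hi).le, Complex.ofReal_prod]
  refine Finset.prod_congr rfl fun i hi => ?_
  rw [← Complex.ofReal_sub, ← Complex.ofReal_sub, csqrt_div_csqrt_of_pos (h i hi)]

lemma inv_csqrt_mul_csqrt_of_mem {t : ℝ} (ht : t ∈ Ioo (-1) 1) :
    (csqrt ((t : ℂ) - (1 : ℝ)) * csqrt ((t : ℂ) - (-1 : ℝ)))⁻¹ =
      -Complex.I * (√((1 - t ^ 2)⁻¹) : ℝ) := by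
  rw [← Complex.ofReal_sub, ← Complex.ofReal_sub, csqrt_ofReal_neg (by linarith [ht.2]),
    csqrt_ofReal_pos (by linarith [ht.1]), mul_assoc, ← Complex.ofReal_mul,
    ← Real.sqrt_mul (by linarith [ht.2]), mul_inv, Complex.inv_I, ← Complex.ofReal_inv,
    ← Real.sqrt_inv]
  congr 4
  ring

lemma inv_csqrt_mul_csqrt_of_notMem {t : ℝ} (ht : t < -1 ∨ 1 < t) :
    (csqrt ((t : ℂ) - (1 : ℝ)) * csqrt ((t : ℂ) - (-1 : ℝ)))⁻¹.im = 0 := by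
  rw [← Complex.ofReal_sub, ← Complex.ofReal_sub]
  rcases ht with h | h
  · rw [csqrt_ofReal_neg (by linarith), csqrt_ofReal_neg (by linarith), mul_mul_mul_comm,
      Complex.I_mul_I, ← Complex.ofReal_mul, ← Complex.ofReal_one, ← Complex.ofReal_neg,
      ← Complex.ofReal_mul, ← Complex.ofReal_inv, Complex.ofReal_im]
  · rw [csqrt_ofReal_pos (by linarith), csqrt_ofReal_pos (by linarith), ← Complex.ofReal_mul,
      ← Complex.ofReal_inv, Complex.ofReal_im]

/-- On E the root of t - 1 contributes a factor -i and all other factors combine to positive reals,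
since no gap contains t. -/
lemma rootS_im_of_mem (h : IsGapSystem α β) {t : ℝ} (ht : t ∈ E α β) (ht' : t ∉ ends α β) :
    (rootS α β t).im = -(Real.pi * w α β t) := by
  have h1 := IsGapSystem.mem_Ioo_of_mem_E ht ht'
  have h2 : 0 < 1 - t ^ 2 := by nlinarith [h1.1, h1.2]
  rw [rootS, inv_csqrt_mul_csqrt_of_mem h1, prod_csqrt_div_of_pos _ fun i _ =>
    h.factor_pos ht' (IsGapSystem.notMem_gap ht i), IsGapSystem.w_eq,
    Real.sqrt_mul (by positivity), mul_assoc, ← Complex.ofReal_mul]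
  have := Real.pi_pos
  simp

/-- Inside the k-th gap only the k-th quotient is imaginary, and its -i meets the -i coming from t -
1. Outside [-1, 1] no factor -i survives. -/
lemma rootS_im_of_notMem (h : IsGapSystem α β) {t : ℝ} (ht : t ∉ E α β) (ht' : t ∉ ends α β) :
    (rootS α β t).im = 0 := by
  classical
  by_cases hI : t ∈ Icc (-1) 1
  · have hU : t ∈ ⋃ i, Ioo (α i) (β i) := by
      by_contra hU
      exact ht ⟨hI, hU⟩
    obtain ⟨k, hk⟩ := mem_iUnion.mp hU
    have hother : ∀ i ∈ Finset.univ.erase k, 0 < (t - α i) / (t - β i) := by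
      intro i hi
      refine h.factor_pos ht' fun hi' => ?_
      rcases lt_trichotomy i k with hlt | heq | hlt
      · have := h.2 i k hlt; linarith [hi'.2, hk.1]
      · exact (Finset.ne_of_mem_erase hi) heq
      · have := h.2 k i hlt; linarith [hk.2, hi'.1]
    have hkk := h.1 k
    rw [rootS, inv_csqrt_mul_csqrt_of_mem ⟨by linarith [hk.1], by linarith [hk.2]⟩,
      ← Finset.mul_prod_erase _ _ (Finset.mem_univ k), prod_csqrt_div_of_pos _ hother,
      ← Complex.ofReal_sub, ← Complex.ofReal_sub, csqrt_ofReal_pos (by linarith [hk.1]),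
      csqrt_ofReal_neg (by linarith [hk.2])]
    have e : ∀ A B C D : ℝ, -Complex.I * (A : ℂ) * ((B : ℂ) / (Complex.I * (C : ℂ)) * (D : ℂ)) =
        ((-(A * (B / C * D)) : ℝ) : ℂ) := by
      intro A B C D
      push_cast
      rw [div_mul_eq_div_div, div_right_comm, div_eq_mul_inv _ Complex.I, Complex.inv_I]
      linear_combination (A * (B / C) * D : ℂ) * Complex.I_mul_I
    rw [e, Complex.ofReal_im]
  · have ht1 : t < -1 ∨ 1 < t := by
      by_contra hc
      push Not at hc
      exact hI hc
    rw [rootS, prod_csqrt_div_of_pos _ fun i _ => h.factor_pos ht' fun hi => ?_, Complex.im_mul_ofReal,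
      inv_csqrt_mul_csqrt_of_notMem ht1, zero_mul]
    have := h.1 i
    rcases ht1 with h1 | h1
    · linarith [hi.1]
    · linarith [hi.2]

lemma rootS_ofReal_of_one_lt (h : IsGapSystem α β) {x : ℝ} (hx : 1 < x) :
    rootS α β x = ((√((∏ i, (x - α i)) / ((x ^ 2 - 1) * ∏ i, (x - β i))) : ℝ) : ℂ) := by
  have hpos : ∀ i, 0 < (x - α i) / (x - β i) := fun i => by
    have := h.1 i
    exact div_pos (by linarith) (by linarith)
  have h2 : 0 < x ^ 2 - 1 := by nlinarith
  rw [rootS, prod_csqrt_div_of_pos _ fun i _ => hpos i, ← Complex.ofReal_sub, ← Complex.ofReal_sub,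
    csqrt_ofReal_pos (by linarith), csqrt_ofReal_pos (by linarith), ← Complex.ofReal_mul,
    ← Complex.ofReal_inv, ← Complex.ofReal_mul, ← Real.sqrt_mul (by linarith), ← Real.sqrt_inv,
    ← Real.sqrt_mul (by rw [inv_nonneg]; nlinarith), Finset.prod_div_distrib]
  congr 2
  rw [show (x - 1) * (x - -1) = x ^ 2 - 1 by ring, ← div_div, div_right_comm, div_eq_inv_mul _ (x ^ 2 - 1)]

/-! ### Contour integration and the closed form of the Stieltjes transform. -/

/-- The integral over the boundary of `[-T, T] × [0, T]` without its bottom, from `-T` to `T`. -/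
noncomputable def threeSides (T : ℝ) (f : ℂ → ℂ) : ℂ :=
  (∫ t in (-T)..T, f (t + T * Complex.I)) - Complex.I * (∫ y in (0 : ℝ)..T, f (T + y * Complex.I)) +
    Complex.I * ∫ y in (0 : ℝ)..T, f ((-T : ℝ) + y * Complex.I)

/-- Continuity along the three sides. -/
structure ContinuousOnSides (T : ℝ) (f : ℂ → ℂ) : Prop where
  top : Continuous fun t : ℝ => f (t + T * Complex.I)
  right : ContinuousOn (fun y : ℝ => f (T + y * Complex.I)) (uIcc 0 T)
  left : ContinuousOn (fun y : ℝ => f ((-T : ℝ) + y * Complex.I)) (uIcc 0 T)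

lemma threeSides_sub {T : ℝ} {f k : ℂ → ℂ} (hf : ContinuousOnSides T f)
    (hk : ContinuousOnSides T k) :
    threeSides T (fun z => f z - k z) = threeSides T f - threeSides T k := by
  unfold threeSides
  rw [intervalIntegral.integral_sub (hf.top.intervalIntegrable _ _) (hk.top.intervalIntegrable _ _),
    intervalIntegral.integral_sub hf.right.intervalIntegrable hk.right.intervalIntegrable,
    intervalIntegral.integral_sub hf.left.intervalIntegrable hk.left.intervalIntegrable]
  ring

lemma threeSides_const_mul (T : ℝ) (c : ℂ) (f : ℂ → ℂ) :
    threeSides T (fun z => c * f z) = c * threeSides T f := by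
  simp only [threeSides, intervalIntegral.integral_const_mul]
  ring

lemma norm_threeSides_le {T C : ℝ} (hT : 0 < T) {f : ℂ → ℂ}
    (hf : ∀ z : ℂ, T ≤ ‖z‖ → 0 ≤ z.im → ‖f z‖ ≤ C) : ‖threeSides T f‖ ≤ 4 * T * C := by
  have h1 : ‖∫ t in (-T)..T, f (t + T * Complex.I)‖ ≤ C * |T - -T| := by
    refine intervalIntegral.norm_integral_le_of_norm_le_const fun t _ => hf _ ?_ ?_
    · refine le_trans ?_ (Complex.abs_im_le_norm _)
      simp [abs_of_pos hT]
    · simp [hT.le]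
  have h2 : ∀ s : ℝ, |s| = T → ‖∫ y in (0 : ℝ)..T, f (s + y * Complex.I)‖ ≤ C * |T - 0| := by
    intro s hs
    refine intervalIntegral.norm_integral_le_of_norm_le_const fun y hy => hf _ ?_ ?_
    · refine le_trans ?_ (Complex.abs_re_le_norm _)
      simp [hs]
    · rw [uIoc_of_le hT.le] at hy
      simp [hy.1.le]
  have h3 := h2 T (abs_of_pos hT)
  have h4 := h2 (-T) (by rw [abs_neg, abs_of_pos hT])
  rw [show T - -T = 2 * T by ring, abs_of_pos (by linarith)] at h1
  rw [sub_zero, abs_of_pos hT] at h3 h4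
  unfold threeSides
  refine (norm_add_le _ _).trans ?_
  refine (add_le_add_left (norm_sub_le _ _) _).trans ?_
  rw [norm_mul, norm_mul, Complex.norm_I, one_mul, one_mul]
  linarith

lemma continuousOnSides_inv {x T : ℝ} (hx : 0 < x) (hT : x < T) :
    ContinuousOnSides T (fun z => (z - x)⁻¹) := by
  have hT0 : T ≠ 0 := by linarith
  refine ⟨Continuous.inv₀ (by fun_prop) fun t h => ?_,
    (Continuous.inv₀ (by fun_prop) fun t h => ?_).continuousOn,
    (Continuous.inv₀ (by fun_prop) fun t h => ?_).continuousOn⟩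
  · exact hT0 (by simpa using congrArg Complex.im h)
  · have := congrArg Complex.re h
    simp at this; linarith
  · have := congrArg Complex.re h
    simp at this; linarith

/-- The logarithm computes the integral of `1 / (z - x)`. -/
lemma threeSides_inv_im {x T : ℝ} (hx : 0 < x) (hT : x < T) :
    (threeSides T (fun z => (z - x)⁻¹)).im = -Real.pi := by
  have hc := continuousOnSides_inv hx hT
  -- The factor -i turns the closed upper half plane with vertex x into the closed right half plane,
  -- which avoids the cut of the logarithm away from the origin.
  set Lg : ℂ → ℂ := fun z => Complex.log (-Complex.I * (z - x)) with hLg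
  have hslit : ∀ z : ℂ, 0 ≤ z.im → z ≠ x → -Complex.I * (z - x) ∈ Complex.slitPlane := by
    intro z hz hzx
    rw [Complex.mem_slitPlane_iff]
    simp
    by_cases h : z.im = 0
    · right
      intro h0
      apply hzx
      apply Complex.ext
      · simp; linarith
      · simpa using h
    · left; exact lt_of_le_of_ne hz (Ne.symm h)
  have hder : ∀ (c d : ℂ) (t : ℝ), 0 ≤ (c + t * d).im → c + t * d ≠ x →
      HasDerivAt (fun t : ℝ => Lg (c + t * d)) (d * (c + t * d - x)⁻¹) t := by
    intro c d t h1 h2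
    have h3 : HasDerivAt (fun t : ℝ => -Complex.I * (c + t * d - x)) (-Complex.I * d) t := by
      have := ((((hasDerivAt_id (t : ℂ)).comp_ofReal.mul_const d).const_add c).sub_const
        (x : ℂ)).const_mul (-Complex.I)
      simpa using this
    have h4 := h3.clog_real (hslit _ h1 h2)
    convert h4 using 1
    rw [neg_mul, neg_mul, neg_div_neg_eq, mul_div_mul_left _ _ Complex.I_ne_zero, div_eq_mul_inv]
  have hT0 : 0 < T := by linarith
  have e1 : (∫ t in (-T)..T, ((t : ℂ) + T * Complex.I - x)⁻¹) =
      Lg (T * Complex.I + T * 1) - Lg (T * Complex.I + (-T : ℝ) * 1) := by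
    rw [← intervalIntegral.integral_eq_sub_of_hasDerivAt (f := fun t : ℝ => Lg (T * Complex.I + t * 1))
      (f' := fun t : ℝ => ((t : ℂ) + T * Complex.I - x)⁻¹)]
    · intro t _
      have := hder (T * Complex.I) 1 t (by simp [hT0.le])
        (fun h => hT0.ne' (by simpa using congrArg Complex.im h))
      simpa [add_comm] using this
    · exact hc.top.intervalIntegrable _ _
  have e2 : ∀ s : ℝ, s ≠ x → ContinuousOn (fun y : ℝ => ((s : ℂ) + y * Complex.I - x)⁻¹) (uIcc 0 T) →
      Complex.I * (∫ y in (0 : ℝ)..T, ((s : ℂ) + y * Complex.I - x)⁻¹) =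
      Lg (s + T * Complex.I) - Lg (s + (0 : ℝ) * Complex.I) := by
    intro s hs hcs
    rw [← intervalIntegral.integral_const_mul,
      ← intervalIntegral.integral_eq_sub_of_hasDerivAt (f := fun t : ℝ => Lg (s + t * Complex.I))
      (f' := fun y : ℝ => Complex.I * ((s : ℂ) + y * Complex.I - x)⁻¹)]
    · intro t ht
      rw [uIcc_of_le hT0.le] at ht
      exact hder s Complex.I t (by simp [ht.1]) (fun h => hs (by simpa using congrArg Complex.re h))
    · exact (continuousOn_const.mul hcs).intervalIntegrable
  have e3 := e2 T (by linarith) hc.right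
  have e4 := e2 (-T) (by linarith) hc.left
  have key : threeSides T (fun z => (z - x)⁻¹) = Lg T - Lg (-T : ℝ) := by
    unfold threeSides
    rw [e1, e3, e4]
    simp only [mul_one, Complex.ofReal_zero, zero_mul, add_zero]
    rw [add_comm (T * Complex.I : ℂ) (T : ℂ), add_comm (T * Complex.I : ℂ) ((-T : ℝ) : ℂ)]
    ring
  have a1 : Lg T = Complex.log ((T - x : ℝ) * -Complex.I) := by
    simp only [hLg]; push_cast; congr 1; ring
  have a2 : Lg (-T : ℝ) = Complex.log ((T + x : ℝ) * Complex.I) := by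
    simp only [hLg]; push_cast; congr 1; ring
  rw [key, a1, a2, Complex.sub_im, Complex.log_im, Complex.log_im,
    Complex.arg_real_mul _ (by linarith), Complex.arg_real_mul _ (by linarith), Complex.arg_neg_I,
    Complex.arg_I]
  ring

/-- Domination of the boundary values of `rootS` by an integrable function. -/
lemma norm_rootS_le (h : IsGapSystem α β) {T t ε : ℝ} (ht : |t| ≤ T) (hε : ε ∈ Ioc (0 : ℝ) 1)
    (ht' : t ∉ ends α β) :
    ‖rootS α β (t + ε * Complex.I)‖ ≤ √((T + 2) ^ g) * √((∏ e ∈ poles β, |t - e|)⁻¹) := by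
  have hz : ∀ e : ℝ, (t : ℂ) + ε * Complex.I ≠ e := fun e he =>
    hε.1.ne' (by simpa using congrArg Complex.im he)
  have hlow : ∀ e : ℝ, |t - e| ≤ ‖(t : ℂ) + ε * Complex.I - e‖ := fun e => by
    refine le_trans ?_ (Complex.abs_re_le_norm _)
    simp
  have hne : ∀ e ∈ ends α β, 0 < |t - e| := fun e he =>
    abs_pos.mpr (sub_ne_zero.mpr fun h0 => ht' (h0 ▸ he))
  have hT : 0 ≤ T := (abs_nonneg t).trans ht
  rw [norm_rootS fun e _ => hz e, h.prod_poles (fun e => |t - e|), ← Real.sqrt_mul (by positivity)]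
  refine Real.sqrt_le_sqrt (mul_le_mul ?_ ?_ (by positivity) (by positivity))
  · have : ∏ i, ‖(t : ℂ) + ε * Complex.I - (α i : ℝ)‖ ≤ ∏ _i : Fin g, (T + 2) := by
      refine Finset.prod_le_prod (fun _ _ => norm_nonneg _) fun i _ => ?_
      have h1 : ‖(t : ℂ) + ε * Complex.I - (α i : ℝ)‖ ≤ |t - α i| + |ε| := by
        refine (Complex.norm_le_abs_re_add_abs_im _).trans ?_
        simp
      have h2 : |t - α i| ≤ T + 1 := by
        have := h.1 i
        have := abs_le.mp ht
        rw [abs_le]; constructor <;> linarith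
      have h3 : |ε| ≤ 1 := by rw [abs_of_pos hε.1]; exact hε.2
      linarith
    simpa using this
  · have hb : 0 < ∏ i, |t - β i| := Finset.prod_pos fun i _ => hne _ (by simp [ends])
    have h1 := hne 1 (by simp [ends])
    have h2 := hne (-1) (by simp [ends])
    refine inv_anti₀ (by positivity) ?_
    refine mul_le_mul (mul_le_mul (hlow 1) (hlow (-1)) (by positivity) (by positivity)) ?_
      (by positivity) (by positivity)
    exact Finset.prod_le_prod (fun _ _ => abs_nonneg _) fun i _ => hlow _

lemma differentiableAt_dslope_rootS (h : IsGapSystem α β) (x : ℝ) {z : ℂ} (hz : 0 < z.im) :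
    DifferentiableAt ℂ (dslope (rootS α β) x) z := by
  refine (differentiableAt_dslope_of_ne ?_).mpr (differentiableAt_rootS h (Or.inl hz))
  rintro rfl
  simp at hz

lemma continuousOn_dslope_rootS (h : IsGapSystem α β) {x : ℝ} (hx : 1 < x) :
    ContinuousOn (dslope (rootS α β) x) {z | 1 < z.re} := by
  have hopen : IsOpen {z : ℂ | 1 < z.re} := isOpen_lt continuous_const Complex.continuous_re
  rw [continuousOn_dslope (hopen.mem_nhds (by simpa using hx))]
  exact ⟨fun z hz => (differentiableAt_rootS h (Or.inr hz)).continuousAt.continuousWithinAt,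
    differentiableAt_rootS h (Or.inr (by simpa using hx))⟩

lemma continuousWithinAt_dslope_rootS {x : ℝ} {z : ℂ} (hzx : z ≠ x)
    (hz : ∀ e ∈ ends α β, z ≠ (e : ℝ)) :
    ContinuousWithinAt (dslope (rootS α β) x) {z | 0 ≤ z.im} z :=
  (continuousWithinAt_dslope_of_ne hzx).mpr (continuousWithinAt_rootS hz)

/-- To the right of the midpoint of 1 and x, the slope is continuous on a compact rectangle because
the singularity at x is removed. To the left, |z - x| is at least (x - 1)/2 and the bound for
`rootS` suffices. -/
lemma dslope_rootS_bound (h : IsGapSystem α β) {x T : ℝ} (hx : 1 < x) (hT : x < T) :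
    ∃ bound : ℝ → ℝ, IntervalIntegrable bound volume (-T) T ∧ ∀ ε ∈ Ioc (0 : ℝ) 1,
      ∀ t ∈ Ioc (-T) T, t ∉ ends α β →
        ‖dslope (rootS α β) x (t + ε * Complex.I)‖ ≤ bound t := by
  have hT0 : 0 < T := by linarith
  have hK : IsCompact (Icc ((1 + x) / 2) T ×ℂ Icc (0 : ℝ) 1) := isCompact_Icc.reProdIm isCompact_Icc
  obtain ⟨C, hC⟩ := hK.exists_bound_of_continuousOn ((continuousOn_dslope_rootS h hx).mono (by
    intro z hz
    have := (Complex.mem_reProdIm.mp hz).1.1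
    simp only [mem_ofPred_eq]
    linarith))
  have hC0 : 0 ≤ |C| := abs_nonneg C
  refine ⟨fun t => (|C| + 2 / (x - 1) * ‖rootS α β x‖) + 2 / (x - 1) * √((T + 2) ^ g) *
      √((∏ e ∈ poles β, |t - e|)⁻¹), intervalIntegrable_const.add
        ((intervalIntegrable_sqrt_inv_prod _ _ _).const_mul _), fun ε hε t ht ht' => ?_⟩
  have hx1 : 0 < 2 / (x - 1) := div_pos two_pos (by linarith)
  by_cases hcase : (1 + x) / 2 ≤ t
  · have := hC (t + ε * Complex.I) (by
      rw [Complex.mem_reProdIm]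
      simp only [Complex.add_re, Complex.ofReal_re, Complex.mul_re, Complex.I_re, mul_zero,
        Complex.ofReal_im, Complex.I_im, mul_one, sub_self, add_zero, Complex.add_im,
        Complex.mul_im, zero_add]
      exact ⟨⟨hcase, ht.2⟩, hε.1.le, hε.2⟩)
    have h2 : 0 ≤ 2 / (x - 1) * ‖rootS α β x‖ := by positivity
    have h3 : 0 ≤ 2 / (x - 1) * √((T + 2) ^ g) * √((∏ e ∈ poles β, |t - e|)⁻¹) := by positivity
    have h4 := le_abs_self C
    linarith
  · have hne : (t : ℂ) + ε * Complex.I ≠ x := fun h0 =>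
      hε.1.ne' (by simpa using congrArg Complex.im h0)
    rw [dslope_of_ne _ hne, slope_def_module, norm_smul, norm_inv]
    have h1 : (x - 1) / 2 ≤ ‖(t : ℂ) + ε * Complex.I - x‖ := by
      refine le_trans ?_ (Complex.abs_re_le_norm _)
      simp
      rw [abs_of_neg (by linarith)]
      linarith
    have h2 : ‖(t : ℂ) + ε * Complex.I - x‖⁻¹ ≤ 2 / (x - 1) := by
      rw [← inv_div]
      exact inv_anti₀ (by linarith) h1
    have h3 := norm_rootS_le h (abs_le.mpr ⟨ht.1.le, ht.2⟩) hε ht'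
    have h4 := norm_sub_le (rootS α β (t + ε * Complex.I)) (rootS α β x)
    calc _ ≤ 2 / (x - 1) * (√((T + 2) ^ g) * √((∏ e ∈ poles β, |t - e|)⁻¹) + ‖rootS α β x‖) :=
          mul_le_mul h2 (h4.trans (by linarith)) (norm_nonneg _) hx1.le
      _ ≤ _ := by rw [mul_add, ← mul_assoc]; linarith

lemma tendsto_dslope_rootS {x t : ℝ} (ht : t ≠ x) (ht' : t ∉ ends α β) :
    Tendsto (fun ε : ℝ => dslope (rootS α β) x (t + ε * Complex.I)) (𝓝[>] 0)
      (𝓝 (dslope (rootS α β) x t)) := by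
  have h1 := continuousWithinAt_dslope_rootS (α := α) (β := β) (x := x) (z := (t : ℂ))
    (by exact_mod_cast ht) (fun e he h0 => ht' (by
      have : t = e := by exact_mod_cast h0
      exact this ▸ he))
  refine Tendsto.comp (y := 𝓝[{z | 0 ≤ z.im}] (t : ℂ)) h1 ?_
  refine tendsto_nhdsWithin_iff.mpr ⟨?_, ?_⟩
  · have : Tendsto (fun ε : ℝ => (t : ℂ) + ε * Complex.I) (𝓝 0) (𝓝 (t + (0 : ℝ) * Complex.I)) :=
      Continuous.tendsto (by fun_prop) 0
    simp only [Complex.ofReal_zero, zero_mul, add_zero] at this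
    exact this.mono_left nhdsWithin_le_nhds
  · filter_upwards [self_mem_nhdsWithin] with ε hε
    simp only [mem_Ioi] at hε
    simpa using hε.le

lemma continuous_dslope_rootS_horizontal (h : IsGapSystem α β) (x : ℝ) {ε : ℝ} (hε : 0 < ε) :
    Continuous fun t : ℝ => dslope (rootS α β) x (t + ε * Complex.I) := by
  rw [continuous_iff_continuousAt]
  intro t
  exact ContinuousAt.comp (g := dslope (rootS α β) x)
    (differentiableAt_dslope_rootS h x (by simpa using hε)).continuousAt (by fun_prop)

lemma ae_ne (x : ℝ) : ∀ᵐ t : ℝ, t ≠ x := by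
  simp [ae_iff, measure_singleton]

lemma intervalIntegrable_dslope_rootS (h : IsGapSystem α β) {x T : ℝ} (hx : 1 < x) (hT : x < T) :
    IntervalIntegrable (fun t : ℝ => dslope (rootS α β) x t) volume (-T) T := by
  obtain ⟨bound, hb, hle⟩ := dslope_rootS_bound h hx hT
  have hTT : -T ≤ T := by linarith
  rw [intervalIntegrable_iff_integrableOn_Ioc_of_le hTT] at hb ⊢
  have hlim : ∀ᵐ t : ℝ, Tendsto (fun ε : ℝ => dslope (rootS α β) x (t + ε * Complex.I)) (𝓝[>] 0)
      (𝓝 (dslope (rootS α β) x t)) := by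
    filter_upwards [ae_notMem_ends (α := α) (β := β), ae_ne x] with t ht' htx
    exact tendsto_dslope_rootS htx ht'
  refine Integrable.mono' hb ?_ ?_
  · obtain ⟨u, -, hu, hu0⟩ := exists_seq_strictAnti_tendsto (0 : ℝ)
    have hu' : Tendsto u atTop (𝓝[>] 0) :=
      tendsto_nhdsWithin_iff.mpr ⟨hu0, Eventually.of_forall hu⟩
    exact aestronglyMeasurable_of_tendsto_ae atTop
      (fun n => (continuous_dslope_rootS_horizontal h x (hu n)).aestronglyMeasurable)
      (ae_restrict_of_ae (hlim.mono fun t ht => ht.comp hu'))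
  · rw [ae_restrict_iff' measurableSet_Ioc]
    filter_upwards [ae_notMem_ends (α := α) (β := β), hlim] with t ht' htl ht
    refine le_of_tendsto htl.norm ?_
    filter_upwards [Ioc_mem_nhdsGT one_pos] with ε hε
    exact hle ε hε t ht ht'

lemma continuousOnSides_dslope_rootS (h : IsGapSystem α β) {x T : ℝ} (hx : 1 < x) (hT : x < T) :
    ContinuousOnSides T (dslope (rootS α β) x) := by
  have hT0 : 0 < T := by linarith
  refine ⟨continuous_dslope_rootS_horizontal h x hT0, ?_, ?_⟩
  · refine (continuousOn_dslope_rootS h hx).comp (by fun_prop) fun y _ => ?_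
    simp only [mem_ofPred_eq]
    simp; linarith
  · intro y hy
    rw [uIcc_of_le hT0.le] at hy
    refine ContinuousWithinAt.comp (g := dslope (rootS α β) x) (t := {z | 0 ≤ z.im})
      (continuousWithinAt_dslope_rootS ?_ ?_) (by fun_prop) ?_
    · intro he
      have := congrArg Complex.re he
      simp at this; linarith
    · intro e he h0
      have h1 := congrArg Complex.re h0
      simp at h1
      have : -1 ≤ e := by
        simp only [ends, mem_union, mem_insert_iff, mem_singleton_iff, mem_range] at he
        rcases he with ((rfl | rfl) | ⟨i, rfl⟩) | ⟨i, rfl⟩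
        · norm_num
        · norm_num
        · exact (h.1 i).1.le
        · have := h.1 i; linarith
      linarith
    · intro s hs
      rw [uIcc_of_le hT0.le] at hs
      simpa using hs.1

/-- Cauchy's theorem for the upper half plane, up to the boundary. -/
lemma integral_dslope_rootS (h : IsGapSystem α β) {x T : ℝ} (hx : 1 < x) (hT : x < T) :
    ∫ t in (-T)..T, dslope (rootS α β) x t = threeSides T (dslope (rootS α β) x) := by
  obtain ⟨bound, hb, hle⟩ := dslope_rootS_bound h hx hT
  have hsides := continuousOnSides_dslope_rootS h hx hT
  set f := dslope (rootS α β) x with hf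
  have hT0 : 0 < T := by linarith
  have hbottom : Tendsto (fun ε : ℝ => ∫ t in (-T)..T, f (t + ε * Complex.I)) (𝓝[>] 0)
      (𝓝 (∫ t in (-T)..T, f t)) := by
    refine intervalIntegral.tendsto_integral_filter_of_dominated_convergence bound ?_ ?_ hb ?_
    · filter_upwards [self_mem_nhdsWithin] with ε hε
      exact (continuous_dslope_rootS_horizontal h x hε).aestronglyMeasurable
    · filter_upwards [Ioc_mem_nhdsGT one_pos] with ε hε
      filter_upwards [ae_notMem_ends (α := α) (β := β)] with t ht' ht
      rw [uIoc_of_le (by linarith)] at ht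
      exact hle ε hε t ht ht'
    · filter_upwards [ae_notMem_ends (α := α) (β := β), ae_ne x] with t ht' htx _
      exact tendsto_dslope_rootS htx ht'
  have hside : ∀ k : ℝ → ℂ, ContinuousOn k (uIcc 0 T) →
      Tendsto (fun ε : ℝ => ∫ y in ε..T, k y) (𝓝[>] 0) (𝓝 (∫ y in (0 : ℝ)..T, k y)) := by
    intro k hk
    have h1 := intervalIntegral.continuousOn_primitive_interval_left (μ := volume)
      (hk.integrableOn_compact isCompact_uIcc)
    have h2 := h1 0 left_mem_uIcc
    refine h2.mono_left ?_
    rw [uIcc_of_le hT0.le, ← nhdsWithin_Ioc_eq_nhdsGT hT0]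
    exact nhdsWithin_mono _ Ioc_subset_Icc_self
  have hcauchy : ∀ᶠ ε : ℝ in 𝓝[>] 0, (∫ t in (-T)..T, f (t + ε * Complex.I)) =
      (∫ t in (-T)..T, f (t + T * Complex.I)) -
        Complex.I * (∫ y in ε..T, f (T + y * Complex.I)) +
        Complex.I * ∫ y in ε..T, f ((-T : ℝ) + y * Complex.I) := by
    filter_upwards [self_mem_nhdsWithin] with ε hε
    simp only [mem_Ioi] at hε
    have := Complex.integral_boundary_rect_eq_zero_of_differentiableOn f
      ((-T : ℝ) + ε * Complex.I) (T + T * Complex.I) (fun z hz => by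
        refine (differentiableAt_dslope_rootS h x ?_).differentiableWithinAt
        have := (Complex.mem_reProdIm.mp hz).2
        simp at this
        rcases le_total ε T with hle | hle
        · rw [uIcc_of_le hle] at this; linarith [this.1]
        · rw [uIcc_of_ge hle] at this; linarith [this.1])
    simp only [Complex.add_re, Complex.ofReal_re, Complex.mul_re, Complex.I_re, mul_zero,
      Complex.ofReal_im, Complex.I_im, mul_one, sub_self, add_zero, Complex.add_im,
      Complex.mul_im, zero_add, smul_eq_mul] at this
    linear_combination this
  refine tendsto_nhds_unique hbottom (Tendsto.congr' (hcauchy.mono fun _ h => h.symm) ?_)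
  exact (tendsto_const_nhds.sub ((hside _ hsides.right).const_mul _)).add ((hside _ hsides.left).const_mul _)

/-- For |z| ≥ T ≥ 2x every end point, and x itself, is at distance at least |z|/2, so `rootS` is
O(1/|z|). Against sides of total length 4T the bound leaves O(1/T). -/
lemma norm_rootS_mul_inv_le (h : IsGapSystem α β) {x T : ℝ} (hx : 1 < x) (hT : 2 * x ≤ T) {z : ℂ}
    (hz : T ≤ ‖z‖) : ‖rootS α β z * (z - x)⁻¹‖ ≤ 2 ^ (g + 2) / T ^ 2 := by
  set r := ‖z‖ with hr
  have hr2 : 2 < r := by linarith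
  have hlow : ∀ e : ℝ, |e| ≤ x → r / 2 ≤ ‖z - (e : ℝ)‖ := fun e he => by
    have := norm_sub_norm_le z (e : ℂ)
    rw [Complex.norm_real, Real.norm_eq_abs] at this
    linarith
  have hends : ∀ e ∈ ends α β, |e| ≤ 1 := by
    intro e he
    simp only [ends, mem_union, mem_insert_iff, mem_singleton_iff, mem_range] at he
    rcases he with ((rfl | rfl) | ⟨i, rfl⟩) | ⟨i, rfl⟩
    · norm_num
    · norm_num
    · have := h.1 i; rw [abs_le]; constructor <;> linarith
    · have := h.1 i; rw [abs_le]; constructor <;> linarith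
  have hlow' : ∀ e ∈ ends α β, r / 2 ≤ ‖z - (e : ℝ)‖ := fun e he =>
    hlow e ((hends e he).trans hx.le)
  have hS : ‖rootS α β z‖ ≤ 2 ^ (g + 1) / r := by
    rw [norm_rootS fun e he h0 => by
      have := hlow' e he
      rw [h0, sub_self, norm_zero] at this
      linarith]
    rw [Real.sqrt_le_left (by positivity)]
    have h1 : ∏ i, ‖z - (α i : ℝ)‖ ≤ ∏ _i : Fin g, (2 * r) := by
      refine Finset.prod_le_prod (fun _ _ => norm_nonneg _) fun i _ => ?_
      have h2 := norm_sub_le z (α i : ℂ)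
      rw [Complex.norm_real, Real.norm_eq_abs] at h2
      have := hends (α i) (by simp [ends])
      linarith
    have h2 : ∏ _i : Fin g, (r / 2) ≤ ∏ i, ‖z - (β i : ℝ)‖ :=
      Finset.prod_le_prod (fun _ _ => by positivity) fun i _ => hlow' _ (by simp [ends])
    have h3 := hlow' 1 (by simp [ends])
    have h4 := hlow' (-1) (by simp [ends])
    simp only [Finset.prod_const, Finset.card_univ, Fintype.card_fin] at h1 h2
    calc _ ≤ (2 * r) ^ g * (r / 2 * (r / 2) * (r / 2) ^ g)⁻¹ := by
          refine mul_le_mul h1 (inv_anti₀ (by positivity) ?_) (by positivity) (by positivity)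
          exact mul_le_mul (mul_le_mul h3 h4 (by positivity) (by positivity)) h2 (by positivity)
            (by positivity)
      _ = (2 ^ (g + 1) / r) ^ 2 := by
          have hr0 : r ≠ 0 := by linarith
          rw [mul_pow, div_pow]
          field_simp
          ring
  have hx' := hlow x (by rw [abs_of_pos (by linarith)])
  have hinv : ‖z - (x : ℂ)‖⁻¹ ≤ 2 / r := by
    rw [← inv_div]
    exact inv_anti₀ (by linarith) hx'
  rw [norm_mul, norm_inv]
  calc _ ≤ 2 ^ (g + 1) / r * (2 / r) := mul_le_mul hS hinv (by positivity) (by positivity)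
    _ = 2 ^ (g + 2) / r ^ 2 := by
        have hr0 : r ≠ 0 := by linarith
        field_simp
        ring
    _ ≤ _ := by
        refine div_le_div_of_nonneg_left (by positivity) (by nlinarith) ?_
        exact pow_le_pow_left₀ (by linarith) hz 2

lemma dslope_rootS_im (h : IsGapSystem α β) {x t : ℝ} (hx : 1 < x) (htx : t ≠ x)
    (ht' : t ∉ ends α β) :
    (dslope (rootS α β) x t).im =
      (E α β).indicator (fun t => Real.pi * (w α β t / (x - t))) t := by
  have hne : (t : ℂ) ≠ x := by exact_mod_cast htx
  have h1 : t - x ≠ 0 := sub_ne_zero.mpr htx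
  have h2 : x - t ≠ 0 := sub_ne_zero.mpr htx.symm
  rw [dslope_of_ne _ hne, slope_def_module, ← Complex.ofReal_sub, ← Complex.ofReal_inv, smul_eq_mul,
    Complex.im_ofReal_mul, Complex.sub_im, rootS_ofReal_of_one_lt h hx, Complex.ofReal_im, sub_zero]
  by_cases ht : t ∈ E α β
  · rw [indicator_of_mem ht, rootS_im_of_mem h ht ht', ← neg_sub x t, inv_neg]
    field_simp
  · rw [indicator_of_notMem ht, rootS_im_of_notMem h ht ht', mul_zero]

/-- The Stieltjes transform of the weight. -/
lemma integral_w_div (h : IsGapSystem α β) {x : ℝ} (hx : 1 < x) :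
    ∫ t in E α β, w α β t / (x - t) =
      √((∏ i, (x - α i)) / ((x ^ 2 - 1) * ∏ i, (x - β i))) := by
  set s := √((∏ i, (x - α i)) / ((x ^ 2 - 1) * ∏ i, (x - β i))) with hs
  have hSx : rootS α β x = (s : ℂ) := rootS_ofReal_of_one_lt h hx
  -- The slope is S(z)/(z - x) - s/(z - x) with S = `rootS`. Over the three sides the second term
  -- contributes exactly πs to the imaginary part and the first at most 4T · 2^{g+2}/T². Along the
  -- real axis the imaginary part is the integral sought times π.
  have key : ∀ T : ℝ, 2 * x ≤ T →
      |Real.pi * (∫ t in E α β, w α β t / (x - t)) - Real.pi * s| ≤ 2 ^ (g + 4) / T := by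
    intro T hT
    have hxT : x < T := by linarith
    have hT0 : 0 < T := by linarith
    have hleft : (∫ t in (-T)..T, dslope (rootS α β) x t).im =
        Real.pi * ∫ t in E α β, w α β t / (x - t) := by
      have h1 := Complex.imCLM.intervalIntegral_comp_comm (intervalIntegrable_dslope_rootS h hx hxT)
      simp only [Complex.imCLM_apply] at h1
      rw [← h1, intervalIntegral.integral_of_le (by linarith)]
      have h2 : ∫ t in Ioc (-T) T, (dslope (rootS α β) x t).im =
          ∫ t in Ioc (-T) T, (E α β).indicator (fun t => Real.pi * (w α β t / (x - t))) t := by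
        refine integral_congr_ae (ae_restrict_of_ae ?_)
        filter_upwards [ae_notMem_ends (α := α) (β := β), ae_ne x] with t ht' htx
        exact dslope_rootS_im h hx htx ht'
      rw [h2, setIntegral_indicator IsGapSystem.measurableSet_E, integral_const_mul,
        inter_eq_self_of_subset_right]
      intro t ht
      have := ht.1
      exact ⟨by linarith [this.1], by linarith [this.2]⟩
    have hinv := continuousOnSides_inv (x := x) (by linarith) hxT
    have hinv' : ContinuousOnSides T (fun z => (-s : ℂ) * (z - x)⁻¹) :=
      ⟨hinv.top.const_mul _, hinv.right.const_mul _, hinv.left.const_mul _⟩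
    have hsub := threeSides_sub (continuousOnSides_dslope_rootS h hx hxT) hinv'
    rw [threeSides_const_mul, ← integral_dslope_rootS h hx hxT] at hsub
    have him := congrArg Complex.im hsub
    rw [Complex.sub_im, hleft, ← Complex.ofReal_neg, Complex.im_ofReal_mul,
      threeSides_inv_im (by linarith) hxT] at him
    have hbd := norm_threeSides_le hT0 (f := fun z => dslope (rootS α β) x z -
      ((-s : ℝ) : ℂ) * (z - x)⁻¹) (C := 2 ^ (g + 2) / T ^ 2) (fun z hz _ => by
        have hzx : z ≠ x := by
          rintro rfl
          rw [Complex.norm_real, Real.norm_eq_abs, abs_of_pos (by linarith)] at hz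
          linarith
        refine le_trans (le_of_eq ?_) (norm_rootS_mul_inv_le h hx hT hz)
        rw [dslope_of_ne _ hzx, slope_def_module, smul_eq_mul, hSx]
        push_cast
        congr 1
        ring)
    have h3 := (Complex.abs_im_le_norm _).trans hbd
    rw [him] at h3
    refine le_trans (le_of_eq ?_) (h3.trans (le_of_eq ?_))
    · congr 1; ring
    · field_simp; ring
  have hlim : Tendsto (fun T : ℝ => (2 : ℝ) ^ (g + 4) / T) atTop (𝓝 0) :=
    tendsto_const_nhds.div_atTop tendsto_id
  have h0 : |Real.pi * (∫ t in E α β, w α β t / (x - t)) - Real.pi * s| ≤ 0 :=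
    ge_of_tendsto hlim ((eventually_ge_atTop (2 * x)).mono fun T hT => key T hT)
  have h1 := abs_nonpos_iff.mp h0
  have := Real.pi_pos
  rw [← mul_sub] at h1
  rcases mul_eq_zero.mp h1 with h2 | h2
  · exact absurd h2 this.ne'
  · linarith

/-! ### Orthogonality and positivity of the recurrence coefficients. -/

/-- Integration of polynomials against the weight. -/
noncomputable def moment (h : IsGapSystem α β) : ℝ[X] →ₗ[ℝ] ℝ where
  toFun p := ∫ t in E α β, p.eval t * w α β t
  map_add' p q := by
    simp only [eval_add, add_mul]
    exact integral_add (h.integrableOn_mul_w p.continuousOn) (h.integrableOn_mul_w q.continuousOn)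
  map_smul' c p := by
    simp only [eval_smul, smul_eq_mul, mul_assoc, RingHom.id_apply]
    exact integral_const_mul _ _

lemma moment_apply (h : IsGapSystem α β) (p : ℝ[X]) :
    moment h p = ∫ t in E α β, p.eval t * w α β t := rfl

lemma ip_eq_moment (h : IsGapSystem α β) (p q : ℝ[X]) : ip α β p q = moment h (p * q) := by
  simp only [ip, moment_apply, eval_mul]

lemma moment_C_mul (h : IsGapSystem α β) (c : ℝ) (p : ℝ[X]) :
    moment h (C c * p) = c * moment h p := by
  rw [← smul_eq_C_mul, map_smul, smul_eq_mul]

lemma moment_sq_pos (h : IsGapSystem α β) {p : ℝ[X]} (hp : p ≠ 0) : 0 < moment h (p * p) := by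
  rw [← ip_eq_moment]; exact h.integral_sq_mul_w_pos hp

lemma monic_P_and_natDegree (n : ℕ) : (P α β n).Monic ∧ (P α β n).natDegree = n := by
  induction n using Nat.strong_induction_on with
  | _ n ih =>
    rw [P]
    have hdeg : (∑ k : Fin n, C (ip α β (X ^ n) (P α β k) / ip α β (P α β k) (P α β k)) *
        P α β k).degree < n := by
      refine (degree_sum_le _ _).trans_lt ?_
      rw [Finset.sup_lt_iff (by exact_mod_cast WithBot.bot_lt_coe n)]
      intro k _
      rw [← smul_eq_C_mul]
      refine (degree_smul_le _ _).trans_lt ?_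
      rw [degree_eq_natDegree (ih k k.2).1.ne_zero, (ih k k.2).2]
      exact_mod_cast k.2
    have hm := monic_X_pow_sub hdeg
    refine ⟨hm, ?_⟩
    refine natDegree_eq_of_degree_eq_some ?_
    rw [degree_sub_eq_left_of_degree_lt (by rwa [degree_X_pow]), degree_X_pow]

lemma monic_P (n : ℕ) : (P α β n).Monic := (monic_P_and_natDegree n).1

lemma natDegree_P (n : ℕ) : (P α β n).natDegree = n := (monic_P_and_natDegree n).2

lemma moment_P_mul_P (h : IsGapSystem α β) (n : ℕ) :
    ∀ m < n, moment h (P α β n * P α β m) = 0 := by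
  induction n using Nat.strong_induction_on with
  | _ n ih =>
    intro m hm
    have hpos := moment_sq_pos h (monic_P (α := α) (β := β) m).ne_zero
    rw [P, sub_mul, map_sub, Finset.sum_mul, map_sum, Finset.sum_eq_single (⟨m, hm⟩ : Fin n)]
    · simp only [ip_eq_moment h, mul_assoc, moment_C_mul]
      rw [div_mul_cancel₀ _ hpos.ne', sub_self]
    · intro k _ hk
      rw [mul_assoc, moment_C_mul]
      rcases lt_or_gt_of_ne (fun h0 => hk (Fin.ext h0) : (k : ℕ) ≠ m) with hlt | hlt
      · rw [mul_comm (P α β k), ih m hm k hlt, mul_zero]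
      · rw [ih k k.2 m hlt, mul_zero]
    · simp

lemma moment_P_mul (h : IsGapSystem α β) (n : ℕ) {q : ℝ[X]} (hq : q.degree < n) :
    moment h (P α β n * q) = 0 := by
  have key : ∀ d ≤ n, ∀ q : ℝ[X], q.degree < d → moment h (P α β n * q) = 0 := by
    intro d
    induction d with
    | zero =>
      intro _ q hq
      have : q = 0 := by simpa using hq
      simp [this]
    | succ d ih =>
      intro hd q hq
      have hr : (q - C (q.coeff d) * P α β d).degree < d := by
        rw [degree_lt_iff_coeff_zero] at hq ⊢
        intro m hm
        rw [coeff_sub, coeff_C_mul]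
        rcases hm.eq_or_lt with rfl | hlt
        · have := (monic_P (α := α) (β := β) d).coeff_natDegree
          rw [natDegree_P] at this
          rw [this]; ring
        · rw [hq m hlt, show (P α β d).coeff m = 0 from
            coeff_eq_zero_of_natDegree_lt (by rw [natDegree_P]; exact hlt)]
          ring
      have e : P α β n * q = P α β n * (q - C (q.coeff d) * P α β d) +
          C (q.coeff d) * (P α β n * P α β d) := by ring
      rw [e, map_add, ih (by omega) _ hr, moment_C_mul, moment_P_mul_P h n d (by omega)]
      ring
  exact key n le_rfl q hq

lemma P_zero : P α β 0 = 1 := by rw [P]; simp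

lemma P_eq_fstKind (hr : IsRecurrence α β a b) (n : ℕ) : P α β n = fstKind a b n := by
  refine ThreeTerm.ext (a := a) (b := b) (fun n => ?_) threeTerm_fstKind ?_ ?_ n
  · have := hr.2 (n + 1) (by omega)
    simp only [Nat.add_sub_cancel] at this
    linear_combination -this
  · rw [P_zero, fstKind]
  · have := hr.1
    rw [P_zero] at this
    rw [fstKind]
    linear_combination -this

/-- Integrating x P_n P_{n+1} in two ways gives ∫P_{n+1}² w = a_{n+1} ∫P_n² w, because x P_n -
P_{n+1} has degree at most n. -/
lemma coeff_pos_of_isRecurrence (h : IsGapSystem α β) (hr : IsRecurrence α β a b) (n : ℕ) :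
    0 < a (n + 1) := by
  have h1 := hr.2 (n + 1) (by omega)
  simp only [Nat.add_sub_cancel] at h1
  have hpn := moment_sq_pos h (monic_P (α := α) (β := β) n).ne_zero
  have hpn1 := moment_sq_pos h (monic_P (α := α) (β := β) (n + 1)).ne_zero
  have hdeg : (X * P α β n - P α β (n + 1)).degree < ((n + 1 : ℕ) : WithBot ℕ) := by
    have hm : (X * P α β n).Monic := monic_X.mul (monic_P n)
    have hd : (X * P α β n).degree = ((n + 1 : ℕ) : WithBot ℕ) := by
      rw [degree_eq_natDegree hm.ne_zero, monic_X.natDegree_mul (monic_P n), natDegree_X,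
        natDegree_P, add_comm]
    have hd' : (P α β (n + 1)).degree = ((n + 1 : ℕ) : WithBot ℕ) := by
      rw [degree_eq_natDegree (monic_P _).ne_zero, natDegree_P]
    rw [← hd]
    exact degree_sub_lt_left (hd.trans hd'.symm) hm.ne_zero (by rw [hm, monic_P (n + 1)])
  have e1 := moment_P_mul h (n + 1) hdeg
  rw [mul_sub, map_sub] at e1
  have e2 : P α β (n + 1) * (X * P α β n) = P α β (n + 2) * P α β n +
      C (b (n + 2)) * (P α β (n + 1) * P α β n) + C (a (n + 1)) * (P α β n * P α β n) := by
    linear_combination P α β n * h1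
  rw [e2, map_add, map_add, moment_C_mul, moment_C_mul, moment_P_mul_P h (n + 2) n (by omega),
    moment_P_mul_P h (n + 1) n (by omega)] at e1
  by_contra! hc
  nlinarith [mul_nonneg (neg_nonneg.mpr hc) hpn.le]

/-! ### Difference quotients and the polynomials of the second kind. -/

/-- The difference quotient of a polynomial. -/
noncomputable def diffQuot (x : ℝ) (p : ℝ[X]) : ℝ[X] := (p - C (p.eval x)) /ₘ (X - C x)

lemma mul_diffQuot (x : ℝ) (p : ℝ[X]) : (X - C x) * diffQuot x p = p - C (p.eval x) :=
  mul_divByMonic_eq_iff_isRoot.mpr (by simp)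

lemma diffQuot_unique {x : ℝ} {p q : ℝ[X]} (h : (X - C x) * q = p - C (p.eval x)) :
    diffQuot x p = q :=
  mul_left_cancel₀ (X_sub_C_ne_zero x) ((mul_diffQuot x p).trans h.symm)

lemma eval_diffQuot {x t : ℝ} (ht : t ≠ x) (p : ℝ[X]) :
    (diffQuot x p).eval t = (p.eval x - p.eval t) / (x - t) := by
  have := congrArg (eval t) (mul_diffQuot x p)
  simp only [eval_mul, eval_sub, eval_X, eval_C] at this
  rw [eq_div_iff (sub_ne_zero.mpr ht.symm)]
  linarith

lemma Q_eq_moment (h : IsGapSystem α β) (n : ℕ) (x : ℝ) :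
    Q α β n x = moment h (diffQuot x (P α β n)) := by
  rw [Q, moment_apply]
  refine integral_congr_ae (ae_restrict_of_ae ?_)
  filter_upwards [ae_ne x] with t ht
  rw [eval_diffQuot ht]

/-- The difference quotients satisfy the recurrence up to an extra term P_{n+1}, which integrates to
0. The total mass in front is shown to be 1 in `moment_one`. -/
lemma Q_eq_sndKind (h : IsGapSystem α β) (hr : IsRecurrence α β a b) (x : ℝ) (n : ℕ) :
    Q α β n x = moment h 1 * (sndKind a b n).eval x := by
  have key : ∀ n, diffQuot x (P α β (n + 2)) =
      C (x - b (n + 2)) * diffQuot x (P α β (n + 1)) + P α β (n + 1) -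
        C (a (n + 1)) * diffQuot x (P α β n) := by
    intro n
    refine diffQuot_unique ?_
    have e1 := mul_diffQuot x (P α β (n + 1))
    have e2 := mul_diffQuot x (P α β n)
    have hrec : P α β (n + 2) = (X - C (b (n + 2))) * P α β (n + 1) - C (a (n + 1)) * P α β n := by
      simp only [P_eq_fstKind hr]; exact threeTerm_fstKind n
    rw [hrec]
    simp only [eval_sub, eval_mul, eval_X, eval_C, C_sub, C_mul]
    linear_combination (C x - C (b (n + 2))) * e1 - C (a (n + 1)) * e2
  rw [Q_eq_moment h]
  induction n using Nat.twoStepInduction with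
  | zero =>
    have : diffQuot x (P α β 0) = 0 := diffQuot_unique (by simp [P_zero])
    simp [this, sndKind]
  | one =>
    have : diffQuot x (P α β 1) = 1 := diffQuot_unique (by simp [P_eq_fstKind hr, fstKind])
    simp [this, sndKind]
  | more n h1 h2 =>
    have h0 := moment_P_mul h (n + 1) (q := 1) (by
      rw [degree_one]; exact_mod_cast Nat.succ_pos n)
    rw [mul_one] at h0
    rw [key, map_sub, map_add, moment_C_mul, moment_C_mul, h1, h2, h0, threeTerm_sndKind n]
    simp only [eval_sub, eval_mul, eval_X, eval_C]
    ring

/-! ### Decay of the functions of the second kind. -/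

/-- The Stieltjes transform of the weight. -/
noncomputable def stieltjes (α β : Fin g → ℝ) (x : ℝ) : ℝ := ∫ t in E α β, w α β t / (x - t)

lemma integrableOn_div (h : IsGapSystem α β) {x : ℝ} (hx : 1 < x) (p : ℝ[X]) :
    IntegrableOn (fun t => p.eval t * w α β t / (x - t)) (E α β) := by
  have := h.integrableOn_mul_w (f := fun t => p.eval t / (x - t))
    (p.continuousOn.div (by fun_prop) fun t ht => by
      have := ht.2; exact (sub_pos.mpr (by linarith)).ne')
  refine this.congr_fun (fun t _ => ?_) IsGapSystem.measurableSet_E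
  beta_reduce
  ring

lemma eval_mul_stieltjes (h : IsGapSystem α β) {x : ℝ} (hx : 1 < x) (p : ℝ[X]) :
    p.eval x * stieltjes α β x - moment h (diffQuot x p) =
      ∫ t in E α β, p.eval t * w α β t / (x - t) := by
  have h1 : IntegrableOn (fun t => w α β t / (x - t)) (E α β) := by
    simpa using integrableOn_div h hx 1
  have h2 : IntegrableOn (fun t => (diffQuot x p).eval t * w α β t) (E α β) :=
    h.integrableOn_mul_w (diffQuot x p).continuousOn
  rw [stieltjes, moment_apply, ← integral_const_mul, ← integral_sub (h1.const_mul _) h2]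
  refine setIntegral_congr_fun IsGapSystem.measurableSet_E fun t ht => ?_
  have h3 : t ≤ 1 := ht.1.2
  have h4 : x - t ≠ 0 := (sub_pos.mpr (by linarith)).ne'
  rw [eval_diffQuot (by linarith)]
  field_simp
  ring

/-- The function of the second kind `P_n F - Q_n`. -/
noncomputable def sndFun (α β : Fin g → ℝ) (n : ℕ) (x : ℝ) : ℝ :=
  (P α β n).eval x * stieltjes α β x - Q α β n x

/-- The function equals ∫P_n(t) w(t)/(x - t) dt. Multiplied by x^n, the power may be moved inside as
t^n: the difference quotient of t^n has degree below n and is orthogonal to P_n. For x ≥ 2 the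
kernel is at most 2/x. -/
lemma sndFun_isBigO (h : IsGapSystem α β) (n : ℕ) :
    sndFun α β n =O[atTop] fun x : ℝ => x ^ (-(n + 1) : ℤ) := by
  set Cn := ∫ t in E α β, |(P α β n * X ^ n).eval t| * w α β t with hC
  refine Asymptotics.IsBigO.of_bound (2 * Cn) ?_
  filter_upwards [eventually_ge_atTop 2] with x hx
  have hx1 : 1 < x := by linarith
  have hx0 : 0 < x := by linarith
  have e1 : sndFun α β n x = ∫ t in E α β, (P α β n).eval t * w α β t / (x - t) := by
    rw [sndFun, Q_eq_moment h, eval_mul_stieltjes h hx1]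
  have hdeg : (diffQuot x (X ^ n : ℝ[X])).degree < n := by
    rcases n.eq_zero_or_pos with rfl | hn
    · have : diffQuot x (X ^ 0 : ℝ[X]) = 0 := diffQuot_unique (by simp)
      rw [this]; simp
    · refine degree_le_natDegree.trans_lt ?_
      rw [diffQuot, natDegree_divByMonic _ (monic_X_sub_C x), natDegree_X_pow_sub_C,
        natDegree_X_sub_C]
      exact_mod_cast (by omega : n - 1 < n)
  have e2 : x ^ n * sndFun α β n x =
      ∫ t in E α β, (P α β n * X ^ n).eval t * w α β t / (x - t) := by
    have h0 := moment_P_mul h n hdeg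
    rw [moment_apply] at h0
    rw [e1, ← integral_const_mul, ← sub_eq_zero, ← h0, ← integral_sub
      ((integrableOn_div h hx1 _).const_mul _) (integrableOn_div h hx1 _)]
    refine setIntegral_congr_fun IsGapSystem.measurableSet_E fun t ht => ?_
    have h3 : t ≤ 1 := ht.1.2
    have h4 : x - t ≠ 0 := (sub_pos.mpr (by linarith)).ne'
    rw [eval_mul, eval_mul, eval_diffQuot (by linarith)]
    simp only [eval_pow, eval_X]
    field_simp
  have e3 : |x ^ n * sndFun α β n x| ≤ 2 / x * Cn := by
    rw [e2, hC, ← integral_const_mul, ← Real.norm_eq_abs]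
    refine (norm_integral_le_integral_norm _).trans ?_
    refine setIntegral_mono_on (integrableOn_div h hx1 _).norm
      ((h.integrableOn_mul_w (P α β n * X ^ n).continuous.abs.continuousOn).const_mul _)
      IsGapSystem.measurableSet_E fun t ht => ?_
    have h3 : t ≤ 1 := ht.1.2
    have h4 : 0 < x - t := by linarith
    rw [norm_div, norm_mul, Real.norm_eq_abs, Real.norm_eq_abs, Real.norm_eq_abs, abs_of_pos h4,
      abs_of_nonneg (IsGapSystem.w_nonneg t), div_eq_inv_mul]
    refine mul_le_mul_of_nonneg_right ?_ (mul_nonneg (abs_nonneg _) (IsGapSystem.w_nonneg t))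
    rw [← inv_div]
    exact inv_anti₀ (by linarith) (by linarith)
  rw [Real.norm_eq_abs, Real.norm_eq_abs, abs_of_pos (a := x ^ (-(n + 1) : ℤ)) (by positivity)]
  rw [abs_mul, abs_of_pos (by positivity : 0 < x ^ n)] at e3
  rw [zpow_neg, show ((n : ℤ) + 1) = ((n + 1 : ℕ) : ℤ) by push_cast; ring, zpow_natCast, pow_succ,
    ← div_eq_mul_inv, le_div_iff₀ (by positivity)]
  have := mul_le_mul_of_nonneg_right e3 hx0.le
  calc _ = x ^ n * |sndFun α β n x| * x := by ring
    _ ≤ _ := this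
    _ = _ := by field_simp

/-! ### The quadratic equation of the Stieltjes transform and rapid decay. -/

/-- The polynomial `∏ (X - α i)`. -/
noncomputable def gapNum (α : Fin g → ℝ) : ℝ[X] := ∏ i, (X - C (α i))

/-- The polynomial `(X² - 1) ∏ (X - β i)`. -/
noncomputable def gapDen (β : Fin g → ℝ) : ℝ[X] := (X ^ 2 - C 1) * ∏ i, (X - C (β i))

lemma eval_gapNum (α : Fin g → ℝ) (x : ℝ) : (gapNum α).eval x = ∏ i, (x - α i) := by
  simp [gapNum, eval_prod]

lemma eval_gapDen (β : Fin g → ℝ) (x : ℝ) :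
    (gapDen β).eval x = (x ^ 2 - 1) * ∏ i, (x - β i) := by
  simp [gapDen, eval_prod]

lemma monic_gapNum (α : Fin g → ℝ) : (gapNum α).Monic := monic_prod_X_sub_C _ _

lemma natDegree_gapNum (α : Fin g → ℝ) : (gapNum α).natDegree = g := by
  rw [gapNum, natDegree_finsetProd_X_sub_C_eq_card]; simp

lemma monic_gapDen (β : Fin g → ℝ) : (gapDen β).Monic :=
  (monic_X_pow_sub_C 1 two_ne_zero).mul (monic_prod_X_sub_C _ _)

lemma natDegree_gapDen (β : Fin g → ℝ) : (gapDen β).natDegree = g + 2 := by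
  rw [gapDen, (monic_X_pow_sub_C 1 two_ne_zero).natDegree_mul (monic_prod_X_sub_C _ _),
    natDegree_X_pow_sub_C, natDegree_finsetProd_X_sub_C_eq_card]
  simp [add_comm]

lemma gapDen_pos (h : IsGapSystem α β) {x : ℝ} (hx : 1 < x) : 0 < (gapDen β).eval x := by
  rw [eval_gapDen]
  refine mul_pos (by nlinarith) (Finset.prod_pos fun i _ => ?_)
  have := h.1 i; linarith

lemma gapNum_pos (h : IsGapSystem α β) {x : ℝ} (hx : 1 < x) : 0 < (gapNum α).eval x := by
  rw [eval_gapNum]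
  refine Finset.prod_pos fun i _ => ?_
  have := h.1 i; linarith

lemma stieltjes_sq (h : IsGapSystem α β) {x : ℝ} (hx : 1 < x) :
    stieltjes α β x ^ 2 * (gapDen β).eval x = (gapNum α).eval x := by
  have h1 := gapDen_pos h hx
  rw [stieltjes, integral_w_div h hx, ← eval_gapNum, ← eval_gapDen, Real.sq_sqrt
    (div_nonneg (gapNum_pos h hx).le h1.le), div_mul_cancel₀ _ h1.ne']

/-- Functions which decay faster than every power at infinity. -/
def RapidDecay (f : ℝ → ℝ) : Prop := ∀ k : ℕ, f =O[atTop] fun x : ℝ => x ^ (-k : ℤ)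

lemma isBigO_zpow_mul {f k : ℝ → ℝ} {m n : ℤ} (hf : f =O[atTop] fun x : ℝ => x ^ m)
    (hk : k =O[atTop] fun x : ℝ => x ^ n) :
    (fun x => f x * k x) =O[atTop] fun x : ℝ => x ^ (m + n) := by
  refine (hf.mul hk).congr' EventuallyEq.rfl ?_
  filter_upwards [eventually_gt_atTop 0] with x hx
  rw [zpow_add₀ hx.ne']

lemma isBigO_zpow_of_le {m n : ℤ} (hmn : m ≤ n) :
    (fun x : ℝ => x ^ m) =O[atTop] fun x : ℝ => x ^ n := by
  refine Asymptotics.IsBigO.of_bound 1 ?_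
  filter_upwards [eventually_ge_atTop 1] with x hx
  rw [one_mul, Real.norm_eq_abs, Real.norm_eq_abs, abs_of_nonneg (by positivity),
    abs_of_nonneg (by positivity)]
  exact zpow_le_zpow_right₀ hx hmn

lemma isBigO_eval (p : ℝ[X]) : (fun x => p.eval x) =O[atTop] fun x : ℝ => x ^ (p.natDegree : ℤ) := by
  have := Polynomial.isBigO_atTop_of_degree_le p (X ^ p.natDegree) (by rw [degree_X_pow]; exact degree_le_natDegree)
  simpa using this

lemma RapidDecay.mul {f k : ℝ → ℝ} (hf : RapidDecay f) {m : ℕ}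
    (hk : k =O[atTop] fun x : ℝ => x ^ (m : ℤ)) : RapidDecay (fun x => f x * k x) := by
  intro n
  have := isBigO_zpow_mul (hf (n + m)) hk
  refine this.trans (isBigO_zpow_of_le ?_)
  push_cast; linarith

lemma RapidDecay.congr {f k : ℝ → ℝ} (hf : RapidDecay f) (h : f =ᶠ[atTop] k) : RapidDecay k :=
  fun n => (hf n).congr' h EventuallyEq.rfl

lemma tendsto_zpow_neg_succ (k : ℕ) : Tendsto (fun x : ℝ => x ^ (-(k + 1 : ℕ) : ℤ)) atTop (𝓝 0) :=
  tendsto_pow_neg_atTop (Nat.succ_ne_zero k)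

lemma RapidDecay.eq_zero {p : ℝ[X]} (hp : RapidDecay fun x => p.eval x) : p = 0 := by
  have h1 : Tendsto (fun x => p.eval x) atTop (𝓝 0) := (hp 1).trans_tendsto (tendsto_zpow_neg_succ 0)
  exact leadingCoeff_eq_zero.mp ((tendsto_nhds_iff p).mp h1).1

lemma stieltjes_isBigO (h : IsGapSystem α β) :
    stieltjes α β =O[atTop] fun x : ℝ => x ^ (-1 : ℤ) := by
  have := sndFun_isBigO h 0
  have e : sndFun α β 0 = stieltjes α β := by
    funext x
    have h0 : diffQuot x (P α β 0) = 0 := diffQuot_unique (by simp [P_zero])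
    rw [sndFun, Q_eq_moment h, h0, P_zero]; simp
  rw [e] at this
  simpa using this

/-- The Stieltjes transform is not rational: quadratic relations up to rapid decay split. -/
lemma quadratic_relation (h : IsGapSystem α β) {A B D : ℝ[X]}
    (hd : RapidDecay fun x => A.eval x * stieltjes α β x ^ 2 + B.eval x * stieltjes α β x + D.eval x) :
    B = 0 ∧ A * gapNum α + D * gapDen β = 0 := by
  set U := A * gapNum α + D * gapDen β with hU
  set V := B * gapDen β with hV
  have hF := stieltjes_isBigO h
  -- Times `gapDen` the given expression is U + VF. The further factor `gapDen`·(U - VF) removes F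
  -- and leaves a polynomial, which must be 0 by rapid decay.
  obtain ⟨m, hm⟩ : ∃ m : ℕ, (fun x => (gapDen β).eval x ^ 2 *
      (U.eval x - V.eval x * stieltjes α β x)) =O[atTop] fun x : ℝ => x ^ (m : ℤ) := by
    have h1 := isBigO_eval (gapDen β ^ 2 * U)
    have h2 := isBigO_zpow_mul (isBigO_eval (gapDen β ^ 2 * V)) hF
    refine ⟨(gapDen β ^ 2 * U).natDegree + (gapDen β ^ 2 * V).natDegree, ?_⟩
    refine ((h1.trans (isBigO_zpow_of_le ?_)).sub (h2.trans (isBigO_zpow_of_le ?_))).congr_left ?_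
    · push_cast; linarith
    · push_cast; linarith
    · intro x
      simp only [eval_mul, eval_pow]; ring
  have h1 : RapidDecay fun x => (gapDen β * U ^ 2 - gapNum α * V ^ 2).eval x := by
    refine (hd.mul hm).congr ?_
    filter_upwards [eventually_gt_atTop 1] with x hx
    have h2 := stieltjes_sq h hx
    simp only [hU, hV, eval_add, eval_mul, eval_sub, eval_pow]
    set s := stieltjes α β x
    set d := (gapDen β).eval x
    rw [← h2]
    ring
  have h2 := h1.eq_zero
  have hN1 : (gapNum α).eval 1 ≠ 0 := by
    rw [eval_gapNum, Finset.prod_ne_zero_iff]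
    intro i _
    have := h.1 i
    exact (sub_pos.mpr (by linarith)).ne'
  have hV0 : V = 0 := by
    by_contra hV0
    have hN0 := (monic_gapNum α).ne_zero
    have hD0 := (monic_gapDen β).ne_zero
    have h3 : gapDen β * U ^ 2 = gapNum α * V ^ 2 := sub_eq_zero.mp h2
    have hU0 : U ≠ 0 := by
      intro h0
      rw [h0] at h3
      have : gapNum α * V ^ 2 = 0 := by rw [← h3]; ring
      rcases mul_eq_zero.mp this with h4 | h4
      · exact hN0 h4
      · exact hV0 (pow_eq_zero_iff two_ne_zero |>.mp h4)
    -- Parity at the point 1: the left side has odd multiplicity, since 1 is a simple zero of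
    -- `gapDen`, and the right side has even multiplicity.
    have h4 := congrArg (rootMultiplicity 1) h3
    rw [rootMultiplicity_mul (mul_ne_zero hD0 (pow_ne_zero _ hU0)),
      rootMultiplicity_mul (mul_ne_zero hN0 (pow_ne_zero _ hV0)), pow_two, pow_two,
      rootMultiplicity_mul (mul_ne_zero hU0 hU0), rootMultiplicity_mul (mul_ne_zero hV0 hV0),
      rootMultiplicity_eq_zero (p := gapNum α) hN1] at h4
    have h5 : rootMultiplicity 1 (gapDen β) = 1 := by
      have e : gapDen β = (X - C 1) * ((X + C 1) * ∏ i, (X - C (β i))) := by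
        rw [gapDen]; simp only [C_1]; ring
      have hne : ((X + C 1) * ∏ i, (X - C (β i)) : ℝ[X]).eval 1 ≠ 0 := by
        simp only [eval_mul, eval_add, eval_X, eval_C, eval_prod, eval_sub]
        refine mul_ne_zero (by norm_num) (Finset.prod_ne_zero_iff.mpr fun i _ => ?_)
        have := h.1 i
        exact (sub_pos.mpr (by linarith)).ne'
      rw [e, rootMultiplicity_mul (by rw [← e]; exact hD0), rootMultiplicity_X_sub_C_self,
        rootMultiplicity_eq_zero hne]
    omega
  have hU0 : U = 0 := by
    rw [hV0] at h2
    have h3 : gapDen β * U ^ 2 = 0 := by rw [← h2]; ring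
    rcases mul_eq_zero.mp h3 with h4 | h4
    · exact absurd h4 (monic_gapDen β).ne_zero
    · exact pow_eq_zero_iff two_ne_zero |>.mp h4
  exact ⟨(mul_eq_zero.mp hV0).resolve_right (monic_gapDen β).ne_zero, hU0⟩

/-! ### From periodic coefficients to the identities for G. -/

lemma sndFun_eq (h : IsGapSystem α β) (hr : IsRecurrence α β a b) (n : ℕ) (x : ℝ) :
    sndFun α β n x = (fstKind a b n).eval x * stieltjes α β x -
      moment h 1 * (sndKind a b n).eval x := by
  rw [sndFun, Q_eq_sndKind h hr, P_eq_fstKind hr]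

/-- The total mass of the weight is `1`. -/
lemma moment_one (h : IsGapSystem α β) (hr : IsRecurrence α β a b) : moment h 1 = 1 := by
  have hF := stieltjes_isBigO h
  have h1 : Tendsto (fun x => sndFun α β 1 x) atTop (𝓝 0) :=
    (sndFun_isBigO h 1).trans_tendsto (by simpa using tendsto_zpow_neg_succ 1)
  have e : ∀ x, sndFun α β 1 x = (P α β 1).eval x * stieltjes α β x - moment h 1 := fun x => by
    rw [sndFun_eq h hr, P_eq_fstKind hr]; simp [sndKind]
  have h2 : Tendsto (fun x => ((P α β 1).eval x * stieltjes α β x) ^ 2) atTop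
      (𝓝 (moment h 1 ^ 2)) := by
    have := (h1.add_const (moment h 1)).pow 2
    simpa [e] using this
  have hP1 := monic_P (α := α) (β := β) 1
  have hPN : (P α β 1 ^ 2 * gapNum α).Monic := (hP1.pow 2).mul (monic_gapNum α)
  have hdeg : (P α β 1 ^ 2 * gapNum α).natDegree = g + 2 := by
    rw [(hP1.pow 2).natDegree_mul (monic_gapNum α), hP1.natDegree_pow, natDegree_P,
      natDegree_gapNum]
    ring
  -- (P_1 F)² is a quotient of monic polynomials of degree g + 2, so it tends to 1; as P_1 F tends
  -- to the mass, the mass squared is 1.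
  have h3 := div_tendsto_atTop_leadingCoeff_div_of_degree_eq (P α β 1 ^ 2 * gapNum α) (gapDen β) (by
    rw [degree_eq_natDegree hPN.ne_zero, degree_eq_natDegree (monic_gapDen β).ne_zero, hdeg,
      natDegree_gapDen])
  rw [hPN, monic_gapDen β, div_one] at h3
  have h4 : (1 : ℝ) = moment h 1 ^ 2 := by
    refine tendsto_nhds_unique (Tendsto.congr' ?_ h3) h2
    filter_upwards [eventually_gt_atTop 1] with x hx
    have h5 := gapDen_pos h hx
    rw [div_eq_iff h5.ne', eval_mul, eval_pow, mul_pow, mul_assoc, stieltjes_sq h hx]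
  have hpos : 0 < moment h 1 := by simpa using moment_sq_pos h (one_ne_zero : (1 : ℝ[X]) ≠ 0)
  nlinarith

lemma sndFun_rec (h : IsGapSystem α β) (hr : IsRecurrence α β a b) (n : ℕ) (x : ℝ) :
    sndFun α β (n + 2) x = (x - b (n + 2)) * sndFun α β (n + 1) x -
      a (n + 1) * sndFun α β n x := by
  simp only [sndFun_eq h hr, threeTerm_fstKind n, threeTerm_sndKind n, eval_sub, eval_mul, eval_X,
    eval_C]
  ring

/-- Shifting by a period multiplies the decaying solution by a function of `x`. -/
lemma rapidDecay_period (h : IsGapSystem α β) (hr : IsRecurrence α β a b) {M : ℕ}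
    (hb : ∀ n, 1 ≤ n → b (n + M) = b n) (ha : ∀ n, 2 ≤ n → a (n + M) = a n) :
    RapidDecay fun x => a (M + 1) * (sndFun α β 1 x * sndFun α β M x) -
      a 1 * (sndFun α β 0 x * sndFun α β (M + 1) x) := by
  have hpos := coeff_pos_of_isRecurrence h hr
  set ψ := sndFun α β with hψ
  -- The Wronskian of ψ and its shift by M is multiplied by a_{m+2} at each step. Since a_1 is
  -- exempt from periodicity, both a_1 and a_{M+1} appear at the start. Letting m grow gives decay
  -- of every order.
  have key : ∀ (m : ℕ) (x : ℝ), ψ (m + 2) x * ψ (m + 1 + M) x - ψ (m + 1) x * ψ (m + 2 + M) x =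
      (∏ i ∈ Finset.range m, a (i + 2)) * (a (M + 1) * (ψ 1 x * ψ M x) -
        a 1 * (ψ 0 x * ψ (M + 1) x)) := by
    intro m x
    induction m with
    | zero =>
      have e1 := sndFun_rec h hr 0 x
      have e2 := sndFun_rec h hr M x
      rw [show b (M + 2) = b 2 by rw [add_comm, hb 2 (by norm_num)]] at e2
      simp only [zero_add, Finset.range_zero, Finset.prod_empty, one_mul] at e1 ⊢
      rw [add_comm 2 M, add_comm 1 M, hψ, e1, e2]
      ring
    | succ m ih =>
      have e1 := sndFun_rec h hr (m + 1) x
      have e2 := sndFun_rec h hr (m + 1 + M) x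
      rw [show b (m + 1 + M + 2) = b (m + 1 + 2) by
        rw [show m + 1 + M + 2 = m + 1 + 2 + M by ring, hb _ (by omega)],
        show a (m + 1 + M + 1) = a (m + 2) by
        rw [show m + 1 + M + 1 = m + 2 + M by ring, ha _ (by omega)]] at e2
      rw [Finset.prod_range_succ, show m + 1 + 2 + M = m + 1 + M + 2 by ring,
        show m + 1 + 1 + M = m + 1 + M + 1 by ring]
      rw [show m + 2 + M = m + 1 + M + 1 by ring] at ih
      rw [hψ] at ih ⊢
      rw [e1, e2]
      linear_combination a (m + 2) * ih
  intro k
  have hprod : 0 < ∏ i ∈ Finset.range k, a (i + 2) := Finset.prod_pos fun i _ => hpos (i + 1)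
  have h1 := (isBigO_zpow_mul (sndFun_isBigO h (k + 2)) (sndFun_isBigO h (k + 1 + M))).trans
    (isBigO_zpow_of_le (n := (-k : ℤ)) (by push_cast; linarith))
  have h2 := (isBigO_zpow_mul (sndFun_isBigO h (k + 1)) (sndFun_isBigO h (k + 2 + M))).trans
    (isBigO_zpow_of_le (n := (-k : ℤ)) (by push_cast; linarith))
  refine ((h1.sub h2).const_mul_left (∏ i ∈ Finset.range k, a (i + 2))⁻¹).congr_left fun x => ?_
  have := key k x
  rw [hψ] at this ⊢
  rw [this, inv_mul_cancel_left₀ hprod.ne']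

lemma monic_sndKind (n : ℕ) : (sndKind a b (n + 1)).Monic ∧ (sndKind a b (n + 1)).natDegree = n := by
  induction n using Nat.twoStepInduction with
  | zero => simp [sndKind]
  | one => simp [sndKind, monic_X_sub_C]
  | more n h1 h2 =>
    have hm : ((X - C (b (n + 1 + 2))) * sndKind a b (n + 1 + 1)).Monic := (monic_X_sub_C _).mul h2.1
    have hd : ((X - C (b (n + 1 + 2))) * sndKind a b (n + 1 + 1)).natDegree = n + 2 := by
      rw [(monic_X_sub_C _).natDegree_mul h2.1, natDegree_X_sub_C, h2.2]
      ring
    have hlt : (C (a (n + 1 + 1)) * sndKind a b (n + 1)).degree <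
        ((X - C (b (n + 1 + 2))) * sndKind a b (n + 1 + 1)).degree := by
      rw [degree_eq_natDegree hm.ne_zero, hd, ← smul_eq_C_mul]
      refine (degree_smul_le _ _).trans_lt (degree_le_natDegree.trans_lt ?_)
      rw [h1.2]
      exact_mod_cast (by omega : n < n + 2)
    rw [show n + 2 + 1 = n + 1 + 2 by ring, threeTerm_sndKind (n + 1)]
    refine ⟨hm.sub_of_left hlt, ?_⟩
    rw [natDegree_eq_of_degree_eq (degree_sub_eq_left_of_degree_lt hlt), hd]

/-- Periodic recurrence coefficients give the algebraic data of a period. -/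
lemma exists_periodicData (h : IsGapSystem α β) (hr : IsRecurrence α β a b) {M : ℕ} (hM : 1 ≤ M)
    (hb : ∀ n, 1 ≤ n → b (n + M) = b n) (ha : ∀ n, 2 ≤ n → a (n + M) = a n) :
    ∃ G, PeriodicData a b M G ∧ G * gapNum α = sndKind a b M * gapDen β := by
  have hpos := coeff_pos_of_isRecurrence h hr
  have hone := moment_one h hr
  set c := a (M + 1) with hc
  have hc0 : 0 < c := hpos M
  have hd := rapidDecay_period h hr hb ha
  have hq := quadratic_relation h
    (A := C c * (fstKind a b 1 * fstKind a b M) - C (a 1) * fstKind a b (M + 1))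
    (B := C (a 1) * sndKind a b (M + 1) - C c * (fstKind a b M + fstKind a b 1 * sndKind a b M))
    (D := C c * sndKind a b M) (hd.congr (Eventually.of_forall fun x => by
      simp only [sndFun_eq h hr, hone, ← hc]
      simp only [eval_sub, eval_mul, eval_add, eval_C, sndKind, fstKind, eval_one, eval_zero]
      ring))
  obtain ⟨hB, hA⟩ := hq
  set κ := a 1 / c with hκ
  have hκc : C (a 1) = C κ * C c := by rw [← C_mul, hκ, div_mul_cancel₀ _ hc0.ne']
  have hCc : (C c : ℝ[X]) ≠ 0 := C_ne_zero.mpr hc0.ne'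
  set G := C κ * fstKind a b (M + 1) - fstKind a b 1 * fstKind a b M with hG
  have hGN : G * gapNum α = sndKind a b M * gapDen β := by
    apply mul_left_cancel₀ hCc
    rw [hκc] at hA
    rw [hG]
    linear_combination -hA
  have hsnd : C κ * sndKind a b (M + 1) = fstKind a b M + fstKind a b 1 * sndKind a b M := by
    apply mul_left_cancel₀ hCc
    rw [hκc] at hB
    linear_combination hB
  have hmon : ∀ n, (fstKind a b n).Monic ∧ (fstKind a b n).natDegree = n := fun n => by
    rw [← P_eq_fstKind hr]; exact ⟨monic_P n, natDegree_P n⟩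
  -- The relation `hGN` forces G to be monic of degree M + 1, while by its definition the
  -- coefficient of that degree is κ - 1.
  have hκ2 : κ = 2 := by
    obtain ⟨m, rfl⟩ : ∃ m, M = m + 1 := ⟨M - 1, by omega⟩
    obtain ⟨hq, hqd⟩ := monic_sndKind (a := a) (b := b) m
    obtain ⟨h1, h1d⟩ := hmon 1
    obtain ⟨h2, h2d⟩ := hmon (m + 1)
    obtain ⟨h3, h3d⟩ := hmon (m + 1 + 1)
    have hGm : G.Monic := (monic_gapNum α).of_mul_monic_right (hGN ▸ hq.mul (monic_gapDen β))
    have hdeg := congrArg natDegree hGN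
    rw [hGm.natDegree_mul (monic_gapNum α), hq.natDegree_mul (monic_gapDen β), natDegree_gapNum,
      natDegree_gapDen, hqd] at hdeg
    have hGd : G.natDegree = m + 1 + 1 := by omega
    have c1 := hGm.coeff_natDegree
    have c2 := h3.coeff_natDegree
    have c3 := (h1.mul h2).coeff_natDegree
    rw [h1.natDegree_mul h2, h1d, h2d, show 1 + (m + 1) = m + 1 + 1 by ring] at c3
    rw [h3d] at c2
    rw [hGd, hG, coeff_sub, coeff_C_mul, c2, c3] at c1
    linarith
  refine ⟨G, ⟨hpos, hM, hb, ha, ?_, ?_, ?_⟩, hGN⟩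
  · rw [← hκ2, hκ, div_mul_cancel₀ _ hc0.ne']
  · rw [hG, hκ2, show (C 2 : ℝ[X]) = 2 from rfl]; ring
  · rw [← hsnd, hκ2]; rfl

end GenChebyshev

/-! ### The interlacing theorem. -/

open GenChebyshev

theorem theorem4p3 (g : ℕ) (α β : Fin g → ℝ) (hgap : GenChebyshev.IsGapSystem α β)
    (K : ℕ) (hper : GenChebyshev.HasPeriod α β K)
    (n j : ℕ) (hn : 1 ≤ n) (hj : 1 ≤ j) (hjK : j < K) :
    (∀ p ∈ GenChebyshev.zerosP α β j, ∀ b ∈ GenChebyshev.setB α β K n j, p < b →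
      ∃ z ∈ GenChebyshev.zerosP α β (n * K + j), p < z ∧ z < b) ∧
    (∀ q ∈ GenChebyshev.zerosQ α β j, ∀ a ∈ GenChebyshev.setA α β K n j, q < a →
      ∃ z ∈ GenChebyshev.zerosP α β (n * K + j), q < z ∧ z < a) ∧
    (∀ p ∈ GenChebyshev.zerosP α β j, p ∈ GenChebyshev.setB α β K n j →
      p ∈ GenChebyshev.zerosP α β (n * K + j)) := by
  obtain ⟨a, b, hr, hb, ha⟩ := hper
  have hb' : ∀ i m, 1 ≤ m → b (m + i * K) = b m := by
    intro i
    induction i with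
    | zero => intro m _; simp
    | succ i ih =>
      intro m hm
      rw [add_mul, one_mul, ← add_assoc, hb _ (by omega), ih m hm]
  have ha' : ∀ i m, 2 ≤ m → a (m + i * K) = a m := by
    intro i
    induction i with
    | zero => intro m _; simp
    | succ i ih =>
      intro m hm
      rw [add_mul, one_mul, ← add_assoc, ha _ (by omega), ih m hm]
  have hKM : K ≤ n * K := Nat.le_mul_of_pos_left K hn
  obtain ⟨G, hD, hG⟩ := exists_periodicData hgap hr (M := n * K) (by omega) (hb' n) (ha' n)
  obtain ⟨j, rfl⟩ : ∃ i, j = i + 1 := ⟨j - 1, by omega⟩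
  have hjM : j + 1 < n * K := by omega
  have hP : ∀ m x, x ∈ zerosP α β m ↔ (fstKind a b m).eval x = 0 := fun m x => by
    rw [← P_eq_fstKind hr]; rfl
  have hQ : ∀ m x, x ∈ zerosQ α β m ↔ (sndKind a b m).eval x = 0 := fun m x => by
    change Q α β m x = 0 ↔ _
    rw [Q_eq_sndKind hgap hr, moment_one hgap hr, one_mul]
  -- Removing the α_i from B allows `gapNum` to be cancelled, so that zeros of Q_M and of `gapDen`
  -- become zeros of G.
  have hB : ∀ x ∈ setB α β K n (j + 1), (sndKind a b (j + 1)).eval x = 0 ∨ G.eval x = 0 := by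
    intro x hx
    have hN : (gapNum α).eval x ≠ 0 := by
      rw [eval_gapNum, Finset.prod_ne_zero_iff]
      intro i _ h0
      exact hx.2 ⟨i, (sub_eq_zero.mp h0).symm⟩
    have e := congrArg (Polynomial.eval x) hG
    rw [Polynomial.eval_mul, Polynomial.eval_mul, eval_gapDen] at e
    have hz : ∀ {r : ℝ}, G.eval x * (gapNum α).eval x = r → r = 0 → G.eval x = 0 :=
      fun h1 h2 => (mul_eq_zero.mp (h1.trans h2)).resolve_right hN
    rcases hx.1 with ((h | ⟨i, h⟩) | h) | h
    · right
      refine hz e ?_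
      rcases h with h | h <;> rw [h] <;> ring
    · right
      refine hz e ?_
      rw [Finset.prod_eq_zero (Finset.mem_univ i) (by rw [h, sub_self])]
      ring
    · exact Or.inl ((hQ _ _).mp h)
    · right
      refine hz e ?_
      rw [(hQ _ _).mp h, zero_mul]
  refine ⟨?_, ?_, ?_⟩
  · intro p hp c hc hpc
    obtain ⟨z, h1, h2, h3⟩ := hD.exists_zero_of_fst_zero hjM hpc ((hP _ _).mp hp) (hB c hc)
    exact ⟨z, (hP _ _).mpr h3, h1, h2⟩
  · intro q hq c hc hqc
    obtain ⟨z, h1, h2, h3⟩ := hD.exists_zero_of_snd_zero hjM hqc ((hQ _ _).mp hq)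
      (hc.symm.imp (hP _ _).mp (hP _ _).mp)
    exact ⟨z, (hP _ _).mpr h3, h1, h2⟩
  · intro p hp hpB
    have e := congrArg (Polynomial.eval p) (hD.fst_add j)
    rw [hP] at hp ⊢
    rw [Polynomial.eval_add, Polynomial.eval_mul, Polynomial.eval_mul, Polynomial.eval_mul, hp,
      Polynomial.eval_ofNat] at e
    rcases hB p hpB with h | h <;> rw [h] at e <;> simpa using e
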